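/- \textbf{Theorem.} Let $d\ge 1$, $\mathbb{R}^d_+=\{x\in\mathbb{R}^d: x_d>0\}$, $0<s<1$, $1<p<2$, let $\alpha,\beta,\alpha+\beta\in(-1,sp)$ and $1+\alpha+\beta\neq sp$. For $a\in\mathbb{R}$ and $k>0$ write $a^{\langle k\rangle}=|a|^k\operatorname{sgn}(a)$, and put $$C_p=\max\left\{\frac{p-1}{p},\frac{p(p-1)}{2}\right\},\qquad \mathcal{D}=\frac{\pi^{\frac{d-1}{2}}\,\Gamma\left(\frac{1+sp}{2}\right)}{\Gamma\left(\frac{d+sp}{2}\right)}\int_0^1\frac{(t^\alpha+t^\beta)\left|1-t^{-\frac{1+\alpha+\beta-sp}{p}}\right|^p}{(1-t)^{1+sp}}\,dt,$$ $$w(x)=x_d^{-\frac{1+\alpha+\beta-sp}{p}},\qquad V(x,y)=\min\{w(x),w(y)\}\,\max\{w(x),w(y)\}^{p-1}.$$ Then $\mathcal{D}>0$. Moreover, for all real-valued $u\in C_c^1(\mathbb{R}^d_+)$ and, if $sp-\alpha-\beta<1$, also for all real-valued $u\in C_c^1(\overline{\mathbb{R}^d_+})$, the integral $\int_{\mathbb{R}^d_+}|u(x)|^p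 x_d^{-(sp-\alpha-\beta)}\,dx$ is finite and $$\int_{\mathbb{R}^d_+}\int_{\mathbb{R}^d_+}\frac{|u(x)-u(y)|^p}{|x-y|^{d+sp}}x_d^\alpha y_d^\beta\,dy\,dx-\mathcal{D}\int_{\mathbb{R}^d_+}\frac{|u(x)|^p}{x_d^{sp-\alpha-\beta}}\,dx \ge C_p\int_{\mathbb{R}^d_+}\int_{\mathbb{R}^d_+}\frac{\left(v(x)^{\langle p/2\rangle}-v(y)^{\langle p/2\rangle}\right)^2}{|x-y|^{d+sp}}V(x,y)\,x_d^\alpha y_d^\beta\,dy\,dx,$$ where $v(x)=u(x)\,x_d^{\frac{1+\alpha+\beta-sp}{p}}$. If in addition $u\ge 0$, the constant $C_p$ can be replaced by $p-1$. For complex-valued $u$ in the same classes, the Hardy integral is also finite and the inequality holds with $v(x)=|u(x)|\,x_d^{\frac{1+\alpha+\beta-sp}{p}}$ and with $C_p$ replaced by $p-1$. (Both double integrals are understood with values in $[0,\infty]$.) -/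

import Mathlib

open MeasureTheory

noncomputable section

namespace HalfSpaceHardy

/-- The open half-space `ℝ^d_+ = {x : x_d > 0}` in dimension `d = n + 1`; the coordinate `x_d` is
`x (Fin.last n)`. -/
def halfSpace (n : ℕ) : Set (EuclideanSpace ℝ (Fin (n + 1))) :=
  {x | 0 < x (Fin.last n)}

/-- The closed half-space `{x : x_d ≥ 0}`, the closure of `halfSpace n`. -/
def closedHalfSpace (n : ℕ) : Set (EuclideanSpace ℝ (Fin (n + 1))) :=
  {x | 0 ≤ x (Fin.last n)}

/-- `u ∈ C_c^1(S)`: `u` is continuously differentiable on `S` (up to the boundary points that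
belong to `S`) and vanishes on `S` outside a compact subset of `S`. Values of `u` outside `S` are
irrelevant. -/
def IsC1c {E F : Type*} [NormedAddCommGroup E] [NormedSpace ℝ E]
    [NormedAddCommGroup F] [NormedSpace ℝ F] (S : Set E) (u : E → F) : Prop :=
  ContDiffOn ℝ 1 u S ∧ ∃ K ⊆ S, IsCompact K ∧ ∀ x ∈ S, x ∉ K → u x = 0

/-- The test functions: all of `C_c^1(ℝ^d_+)`, and moreover all of `C_c^1` of the closed half-space
in the case `1 + α + β > sp`. -/
def IsTestFunction {F : Type*} [NormedAddCommGroup F] [NormedSpace ℝ F]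
    (n : ℕ) (s p α β : ℝ) (u : EuclideanSpace ℝ (Fin (n + 1)) → F) : Prop :=
  IsC1c (halfSpace n) u ∨ (s * p < 1 + α + β ∧ IsC1c (closedHalfSpace n) u)

/-- The French power `a^⟨k⟩ = |a|^k sgn a`. -/
def frenchPow (a k : ℝ) : ℝ := |a| ^ k * Real.sign a

/-- The constant `C_p`. -/
def remainderConst (p : ℝ) : ℝ := max ((p - 1) / p) (p * (p - 1) / 2)

/-- The constant `𝒟(d, s, p, α, β)`. -/
def hardyConst (d : ℕ) (s p α β : ℝ) : ℝ :=
  Real.pi ^ (((d : ℝ) - 1) / 2) * Real.Gamma ((1 + s * p) / 2) / Real.Gamma ((d + s * p) / 2) *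
    ∫ t in (0 : ℝ)..1,
      (t ^ α + t ^ β) * |1 - t ^ (-((1 + α + β - s * p) / p))| ^ p / (1 - t) ^ (1 + s * p)

/-- The weighted Gagliardo energy
`∬ |u(x) - u(y)|^p |x - y|^{-d-sp} x_d^α y_d^β dy dx`, with values in `[0, ∞]`. -/
def energy {F : Type*} [NormedAddCommGroup F] (n : ℕ) (s p α β : ℝ)
    (u : EuclideanSpace ℝ (Fin (n + 1)) → F) : ENNReal :=
  ∫⁻ x in halfSpace n, ∫⁻ y in halfSpace n,
    ENNReal.ofReal (‖u x - u y‖ ^ p / ‖x - y‖ ^ (((n + 1 : ℕ) : ℝ) + s * p) *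
      x (Fin.last n) ^ α * y (Fin.last n) ^ β)

/-- The Hardy term `∫ |u(x)|^p x_d^{-(sp-α-β)} dx`, with values in `[0, ∞]`. -/
def hardyTerm {F : Type*} [NormedAddCommGroup F] (n : ℕ) (s p α β : ℝ)
    (u : EuclideanSpace ℝ (Fin (n + 1)) → F) : ENNReal :=
  ∫⁻ x in halfSpace n, ENNReal.ofReal (‖u x‖ ^ p / x (Fin.last n) ^ (s * p - α - β))

/-- The function `w(x) = x_d^{-(1+α+β-sp)/p}`. -/
def groundState (n : ℕ) (s p α β : ℝ) (x : EuclideanSpace ℝ (Fin (n + 1))) : ℝ :=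
  x (Fin.last n) ^ (-((1 + α + β - s * p) / p))

/-- The weight `V(x, y) = min {w(x), w(y)} * max {w(x), w(y)}^{p-1}`. -/
def remainderWeight (n : ℕ) (s p α β : ℝ) (x y : EuclideanSpace ℝ (Fin (n + 1))) : ℝ :=
  min (groundState n s p α β x) (groundState n s p α β y) *
    max (groundState n s p α β x) (groundState n s p α β y) ^ (p - 1)

/-- The remainder
`∬ (v(x)^⟨p/2⟩ - v(y)^⟨p/2⟩)^2 |x - y|^{-d-sp} V(x, y) x_d^α y_d^β dy dx`,
with values in `[0, ∞]`. -/
def remainder (n : ℕ) (s p α β : ℝ) (v : EuclideanSpace ℝ (Fin (n + 1)) → ℝ) : ENNReal :=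
  ∫⁻ x in halfSpace n, ∫⁻ y in halfSpace n,
    ENNReal.ofReal ((frenchPow (v x) (p / 2) - frenchPow (v y) (p / 2)) ^ 2 /
      ‖x - y‖ ^ (((n + 1 : ℕ) : ℝ) + s * p) *
      remainderWeight n s p α β x y * x (Fin.last n) ^ α * y (Fin.last n) ^ β)

/-- The inequality `energy u - 𝒟 * hardyTerm u ≥ C * remainder v`. All three integrals are in
`[0, ∞]`; the subtracted one is required to be finite, so that the difference makes sense, and
is moved to the other side. -/
def HardyWithRemainder {F : Type*} [NormedAddCommGroup F] (n : ℕ) (s p α β C : ℝ)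
    (u : EuclideanSpace ℝ (Fin (n + 1)) → F) (v : EuclideanSpace ℝ (Fin (n + 1)) → ℝ) : Prop :=
  hardyTerm n s p α β u < ⊤ ∧
    ENNReal.ofReal (hardyConst (n + 1) s p α β) * hardyTerm n s p α β u +
      ENNReal.ofReal C * remainder n s p α β v ≤ energy n s p α β u

end HalfSpaceHardy

end

namespace HalfSpaceHardy

/-! Put `g = (1+α+β-sp)/p`, `w = x_d^{-g}` and `u = w v`. For two points let `M ≥ m > 0` be the
values of `w` and `A`, `B` the corresponding values of `v`. Everything rests on the pointwise
inequality `weighted_gap`: |MA - mB|^p ≥ (M-m)^{p-1} (M|A|^p - m|B|^p) + C (A^⟨p/2⟩ - B^⟨p/2⟩)^2 m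
M^{p-1}. Integrated against the symmetrised kernel, the left side gives the energy and the last term
the remainder. The middle term gives `𝒟` times the Hardy term, because the power `w` is a ground
state.

By homogeneity the pointwise inequality involves only `a = A/B` and `t = m/M ∈ [0,1]`, and it
becomes calculus in `t`. The constant `p - 1` works for `a ≥ 0` (`gap_of_nonneg`) and still for `-1
≤ a < 0`; only `a < -1` calls for the smaller `C_p` (`gap_of_real`).

The two halves of the middle term may diverge separately near the diagonal. The integration is
therefore done over pairs with `y_d < θ x_d`, `θ < 1`. There both halves are explicit multiples of
the Hardy term (`lintegral_wedge_flux_fst`, `lintegral_wedge_flux_snd`): slicing by hyperplanes and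
scaling reduce them to integrals over `(0, θ)`. Those integrals differ exactly by the truncated
integral defining `𝒟` (`fluxProfile_mul_of_pos`, `fluxProfile_eq_of_neg`). Cancelling the smaller,
finite half gives `truncated_hardy`, and monotone convergence as `θ → 1` finishes.

Test functions enter only through continuity on the half-space and finiteness of the Hardy term. A
complex `u` is replaced by its modulus, which does not increase the energy. -/

/-! ### Elementary one-variable inequalities -/

/-- A negative value inside forces `M'` to be negative and later positive, hence `M'' > 0` somewhere
in between, which excludes concavity. In the second alternative `M' 0 ≥ 0` also forces `M'' < 0` at
an earlier point, against monotonicity of `M''`. -/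
lemma nonneg_of_second_deriv_dichotomy {M M' M'' : ℝ → ℝ} (hc : ContinuousOn M (Set.Icc 0 1))
    (h1 : ∀ t ∈ Set.Ico (0 : ℝ) 1, HasDerivAt M (M' t) t)
    (h2 : ∀ t ∈ Set.Ico (0 : ℝ) 1, HasDerivAt M' (M'' t) t)
    (h3 : (∀ t ∈ Set.Ioo (0 : ℝ) 1, M'' t ≤ 0) ∨
      (0 ≤ M' 0 ∧ ∀ r t, 0 < r → r ≤ t → t < 1 → M'' t ≤ M'' r))
    (M0 : M 0 = 0) (M1 : 0 ≤ M 1) {t : ℝ} (ht : t ∈ Set.Icc (0 : ℝ) 1) : 0 ≤ M t := by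
  by_contra! hlt
  have ht0 : 0 < t := lt_of_le_of_ne ht.1 (by rintro rfl; linarith)
  have ht1 : t < 1 := lt_of_le_of_ne ht.2 (by rintro rfl; linarith)
  obtain ⟨x, hx, hx'⟩ := exists_hasDerivAt_eq_slope M M' ht0
    (hc.mono (Set.Icc_subset_Icc le_rfl ht.2))
    (fun y hy => h1 y ⟨hy.1.le, hy.2.trans ht1⟩)
  obtain ⟨z, hz, hz'⟩ := exists_hasDerivAt_eq_slope M M' ht1
    (hc.mono (Set.Icc_subset_Icc ht.1 le_rfl))
    (fun y hy => h1 y ⟨ht0.le.trans hy.1.le, hy.2⟩)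
  have hxneg : M' x < 0 := by
    rw [hx']; exact div_neg_of_neg_of_pos (by linarith) (by linarith)
  have hzpos : 0 < M' z := by
    rw [hz']; exact div_pos (by linarith) (by linarith)
  have hxz : x < z := hx.2.trans hz.1
  have hM'c : ∀ a b, 0 ≤ a → b < 1 → ContinuousOn M' (Set.Icc a b) := fun a b ha hb y hy =>
    (h2 y ⟨ha.trans hy.1, hy.2.trans_lt hb⟩).continuousAt.continuousWithinAt
  obtain ⟨η, hη, hη'⟩ := exists_hasDerivAt_eq_slope M' M'' hxz (hM'c x z hx.1.le hz.2)
    (fun y hy => h2 y ⟨hx.1.le.trans hy.1.le, hy.2.trans hz.2⟩)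
  have hηpos : 0 < M'' η := by
    rw [hη']; exact div_pos (by linarith) (by linarith)
  rcases h3 with h3 | ⟨h0, h3⟩
  · exact absurd (h3 η ⟨hx.1.trans hη.1, hη.2.trans hz.2⟩) (not_le.2 hηpos)
  · obtain ⟨ζ, hζ, hζ'⟩ := exists_hasDerivAt_eq_slope M' M'' hx.1 (hM'c 0 x le_rfl (hxz.trans hz.2))
      (fun y hy => h2 y ⟨hy.1.le, hy.2.trans (hxz.trans hz.2)⟩)
    have hζneg : M'' ζ < 0 := by
      rw [hζ']; exact div_neg_of_neg_of_pos (by linarith) (by linarith [hx.1])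
    have := h3 ζ η hζ.1 (hζ.2.trans hη.1).le (hη.2.trans hz.2)
    linarith

/-- The difference is concave and vanishes at both endpoints. -/
lemma one_add_sq_le_two_rpow {x : ℝ} (hx : x ∈ Set.Icc (0 : ℝ) 1) : 1 + x ^ 2 ≤ (2 : ℝ) ^ x := by
  have hd : ∀ t : ℝ, HasDerivAt (fun t : ℝ => (2 : ℝ) ^ t) (2 ^ t * Real.log 2) t := fun t =>
    Real.hasStrictDerivAt_const_rpow (by norm_num) t |>.hasDerivAt
  have key := nonneg_of_second_deriv_dichotomy (M := fun t : ℝ => (2 : ℝ) ^ t - 1 - t ^ 2)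
    (M' := fun t => 2 ^ t * Real.log 2 - 2 * t) (M'' := fun t => 2 ^ t * Real.log 2 * Real.log 2 - 2)
    (fun t _ => by
      refine ContinuousAt.continuousWithinAt ?_
      exact ((hd t).continuousAt.sub continuousAt_const).sub (by fun_prop))
    (fun t _ => by
      have := ((hd t).sub_const 1).sub (hasDerivAt_pow 2 t)
      exact this.congr_deriv (by simp))
    (fun t _ => by
      have := ((hd t).mul_const (Real.log 2)).sub ((hasDerivAt_id t).const_mul 2)
      exact this.congr_deriv (by simp))
    (Or.inl fun t ht => by
      have h2 : (2 : ℝ) ^ t ≤ 2 := by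
        simpa using Real.rpow_le_rpow_of_exponent_le (x := 2) (by norm_num) ht.2.le
      have h3 : (0 : ℝ) < 2 ^ t := by positivity
      have h4 := Real.log_two_lt_d9
      have h5 := Real.log_two_gt_d9
      have h6 : Real.log 2 * Real.log 2 ≤ 1 := by nlinarith
      nlinarith)
    (by simp) (by norm_num) hx
  linarith

lemma tangent_le_rpow {x p : ℝ} (hx : 0 ≤ x) (hp : 1 ≤ p) : 1 + p * (x - 1) ≤ x ^ p := by
  simpa using one_add_mul_self_le_rpow_one_add (s := x - 1) (by linarith) hp

lemma rpow_le_tangent {x p : ℝ} (hx : 0 ≤ x) (hp0 : 0 ≤ p) (hp1 : p ≤ 1) :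
    x ^ p ≤ 1 + p * (x - 1) := by
  simpa using rpow_one_add_le_one_add_mul_self (s := x - 1) (by linarith) hp0 hp1

/-- Invert the tangent bound for `x ^ r` and use `1 - y ≤ 1 / (1 + y)`. -/
lemma tangent_le_rpow_neg {x r : ℝ} (hx : 0 < x) (hr0 : 0 ≤ r) (hr1 : r ≤ 1) :
    1 - r * (x - 1) ≤ x ^ (-r) := by
  have h := rpow_le_tangent hx.le hr0 hr1
  have hpos : 0 < x ^ r := by positivity
  rw [Real.rpow_neg hx.le]
  calc 1 - r * (x - 1) ≤ (1 + r * (x - 1))⁻¹ := by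
        rw [← one_div, le_div_iff₀ (by linarith)]; nlinarith [sq_nonneg (r * (x - 1))]
    _ ≤ (x ^ r)⁻¹ := by gcongr

/-! ### The normalised pointwise inequality in `a` and `t` -/

/-- The sign `σ` covers two cases at once: `σ = -1` for a ratio `a > t`, and `σ = 1` for a ratio
`-b`, with `b` in place of `a`. The parameter `q` stands for the `p`-th power of the modulus of the
ratio. -/
lemma hasDerivAt_gap {a σ q t : ℝ} (p : ℝ) (h1 : a + σ * t ≠ 0) (h2 : 1 - t ≠ 0) :
    HasDerivAt (fun t => (a + σ * t) ^ p - (1 - t) ^ (p - 1) * (q - t))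
      (σ * p * (a + σ * t) ^ (p - 1) + (p - 1) * (1 - t) ^ (p - 2) * (q - 1)
        + p * (1 - t) ^ (p - 1)) t := by
  have e1 : HasDerivAt (fun t => a + σ * t) σ t := by
    simpa using ((hasDerivAt_id t).const_mul σ).const_add a
  have e2 : HasDerivAt (fun t : ℝ => 1 - t) (-1) t := by
    simpa using (hasDerivAt_id t).const_sub 1
  have e3 : HasDerivAt (fun t : ℝ => q - t) (-1) t := by
    simpa using (hasDerivAt_id t).const_sub q
  have := (e1.rpow_const (p := p) (Or.inl h1)).sub
    ((e2.rpow_const (p := p - 1) (Or.inl h2)).mul e3)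
  refine this.congr_deriv ?_
  have : (1 - t) ^ (p - 1) = (1 - t) ^ (p - 2) * (1 - t) := by
    rw [← Real.rpow_add_one h2]; ring_nf
  rw [show p - 1 - 1 = p - 2 by ring, this]; ring

lemma hasDerivAt_deriv_gap {a σ q t : ℝ} (p : ℝ) (h1 : a + σ * t ≠ 0) (h2 : 1 - t ≠ 0) :
    HasDerivAt (fun t => σ * p * (a + σ * t) ^ (p - 1) + (p - 1) * (1 - t) ^ (p - 2) * (q - 1)
        + p * (1 - t) ^ (p - 1))
      ((p - 1) * (σ ^ 2 * p * (a + σ * t) ^ (p - 2) + (2 - p) * (1 - t) ^ (p - 3) * (q - 1)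
        - p * (1 - t) ^ (p - 2))) t := by
  have e1 : HasDerivAt (fun t => a + σ * t) σ t := by
    simpa using ((hasDerivAt_id t).const_mul σ).const_add a
  have e2 : HasDerivAt (fun t : ℝ => 1 - t) (-1) t := by
    simpa using (hasDerivAt_id t).const_sub 1
  have := (((e1.rpow_const (p := p - 1) (Or.inl h1)).const_mul (σ * p)).add
    (((e2.rpow_const (p := p - 2) (Or.inl h2)).const_mul (p - 1)).mul_const (q - 1))).add
    ((e2.rpow_const (p := p - 1) (Or.inl h2)).const_mul p)
  refine this.congr_deriv ?_
  rw [show p - 1 - 1 = p - 2 by ring, show p - 2 - 1 = p - 3 by ring]; ring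

lemma rpow_half_sq {a : ℝ} (ha : 0 ≤ a) (p : ℝ) : (a ^ (p / 2)) ^ 2 = a ^ p := by
  rw [← Real.rpow_natCast, ← Real.rpow_mul ha]; norm_num

/-- The right side is convex in `t` on the relevant range and vanishes at `t = 0`, so it lies above
its tangent line there. The slope at `0` already dominates the required square. -/
lemma gap_of_lt {p : ℝ} (hp1 : 1 < p) (hp2 : p < 2) {a t : ℝ} (ha : 0 < a) (ht0 : 0 < t)
    (hta : t < a) (ht1 : t < 1) :
    (p - 1) * t * (a ^ (p / 2) - 1) ^ 2 ≤ (a - t) ^ p - (1 - t) ^ (p - 1) * (a ^ p - t) := by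
  have hsq := rpow_half_sq ha.le p
  set N : ℝ → ℝ := fun t => (a + (-1) * t) ^ p - (1 - t) ^ (p - 1) * (a ^ p - t) with hN
  set N' : ℝ → ℝ := fun t => (-1) * p * (a + (-1) * t) ^ (p - 1)
    + (p - 1) * (1 - t) ^ (p - 2) * (a ^ p - 1) + p * (1 - t) ^ (p - 1) with hN'
  set N'' : ℝ → ℝ := fun t => (p - 1) * ((-1) ^ 2 * p * (a + (-1) * t) ^ (p - 2)
    + (2 - p) * (1 - t) ^ (p - 3) * (a ^ p - 1) - p * (1 - t) ^ (p - 2)) with hN''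
  have d1 : ∀ y ∈ Set.Icc 0 t, HasDerivAt N (N' y) y := fun y hy =>
    hasDerivAt_gap p (by linarith [hy.2]) (by linarith [hy.2])
  have d2 : ∀ y ∈ Set.Icc 0 t, HasDerivAt N' (N'' y) y := fun y hy =>
    hasDerivAt_deriv_gap p (by linarith [hy.2]) (by linarith [hy.2])
  obtain ⟨x, hx, hx'⟩ := exists_hasDerivAt_eq_slope N N' ht0
    (fun y hy => (d1 y hy).continuousAt.continuousWithinAt)
    (fun y hy => d1 y ⟨hy.1.le, hy.2.le⟩)
  obtain ⟨z, hz, hz'⟩ := exists_hasDerivAt_eq_slope N' N'' hx.1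
    (fun y hy => (d2 y ⟨hy.1, hy.2.trans hx.2.le⟩).continuousAt.continuousWithinAt)
    (fun y hy => d2 y ⟨hy.1.le, hy.2.le.trans hx.2.le⟩)
  have hzt : z < t := hz.2.trans hx.2
  -- After division by `(1-z)^{p-2}`, with `x = (a-z)/(1-z)`, the tangent bounds for `x^{p-2}` and
  -- `a^p` at `1` have linear terms that cancel exactly, since `(a-1)/(1-z) = x-1`.
  have hz0 : 0 ≤ N'' z := by
    have l0 : 0 < 1 - z := by linarith
    have a0 : 0 < a - z := by linarith
    have hc := tangent_le_rpow_neg (x := (a - z) / (1 - z)) (r := 2 - p) (by positivity)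
      (by linarith) (by linarith)
    rw [Real.div_rpow a0.le l0.le, neg_sub] at hc
    have e0 : (0 : ℝ) < (1 - z) ^ (p - 2) := by positivity
    have e3 : (1 - z) ^ (p - 3) = (1 - z) ^ (p - 2) / (1 - z) := by
      rw [← Real.rpow_sub_one l0.ne']; ring_nf
    have hB := tangent_le_rpow ha.le hp1.le
    rw [le_div_iff₀ e0] at hc
    have h5 : (2 - p) * (1 - z) ^ (p - 3) * (p * (a - 1)) ≤
        (2 - p) * (1 - z) ^ (p - 3) * (a ^ p - 1) := by
      have : 0 < (1 - z) ^ (p - 3) := by positivity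
      exact mul_le_mul_of_nonneg_left (by linarith) (mul_nonneg (by linarith) this.le)
    have h6 : (2 - p) * (1 - z) ^ (p - 3) * (p * (a - 1)) =
        p * ((2 - p) * ((a - z) / (1 - z) - 1) * (1 - z) ^ (p - 2)) := by
      rw [e3]; field_simp; ring
    have h7 : p * ((1 - (2 - p) * ((a - z) / (1 - z) - 1)) * (1 - z) ^ (p - 2)) ≤
        p * (a - z) ^ (p - 2) := mul_le_mul_of_nonneg_left hc (by linarith)
    simp only [hN'']
    apply mul_nonneg (by linarith)
    rw [show a + -1 * z = a - z by ring]
    nlinarith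
  have hx0 : N' 0 ≤ N' x := by
    rw [hz', sub_zero, div_nonneg_iff] at hz0
    rcases hz0 with h | h
    · linarith [h.1]
    · linarith [h.2, hx.1]
  have hNt : t * N' 0 ≤ N t := by
    have hN0 : N 0 = 0 := by simp [hN]
    rw [hN0, sub_zero, sub_zero, eq_div_iff ht0.ne'] at hx'
    rw [← hx', mul_comm]; gcongr
  have hN'0 : N' 0 = 1 - p * a ^ (p - 1) + (p - 1) * a ^ p := by simp [hN']; ring
  have hfin : (p - 1) * (a ^ (p / 2) - 1) ^ 2 ≤ N' 0 := by
    -- `p a^{p-1} ≤ (2 - p) + 2 (p - 1) a^{p/2}` by weighted Young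
    have hy := rpow_le_tangent (x := a ^ (p / 2)) (p := (p - 1) / (p / 2)) (by positivity)
      (by apply div_nonneg <;> linarith) (by rw [div_le_one (by linarith)]; linarith)
    rw [← Real.rpow_mul ha.le, mul_div_cancel₀ _ (by linarith : p / 2 ≠ 0)] at hy
    have : p * a ^ (p - 1) ≤ p + 2 * (p - 1) * (a ^ (p / 2) - 1) := by
      calc p * a ^ (p - 1) ≤ p * (1 + (p - 1) / (p / 2) * (a ^ (p / 2) - 1)) := by gcongr
        _ = _ := by field_simp
    rw [hN'0]
    nlinarith
  calc (p - 1) * t * (a ^ (p / 2) - 1) ^ 2 = t * ((p - 1) * (a ^ (p / 2) - 1) ^ 2) := by ring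
    _ ≤ t * N' 0 := by gcongr
    _ ≤ N t := hNt
    _ = _ := by simp only [hN]; ring_nf

/-- Since `a ≤ 1`, the square is at most `(1-a)^2`. Subadditivity of `r ↦ r^{p-1}` then splits
`(1-a)^{p-1}` into contributions of `t-a` and `1-t`, matching the two terms on the right. -/
lemma gap_of_le {p : ℝ} (hp1 : 1 < p) (hp2 : p < 2) {a t : ℝ} (ha : 0 ≤ a) (hat : a ≤ t)
    (ht1 : t ≤ 1) (ht0 : 0 < t) :
    (p - 1) * t * (a ^ (p / 2) - 1) ^ 2 ≤ (t - a) ^ p - (1 - t) ^ (p - 1) * (a ^ p - t) := by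
  rcases ha.eq_or_lt with rfl | ha0
  · have h1 : t ^ p = t * t ^ (p - 1) := by rw [mul_comm, ← Real.rpow_add_one ht0.ne']; ring_nf
    have h2 : t ≤ t ^ (p - 1) := by
      simpa using Real.rpow_le_rpow_of_exponent_ge ht0 ht1 (by linarith : p - 1 ≤ 1)
    have h3 : 1 - t ≤ (1 - t) ^ (p - 1) := by
      rcases ht1.eq_or_lt with rfl | h
      · simp [Real.zero_rpow (by linarith : p - 1 ≠ 0)]
      · simpa using Real.rpow_le_rpow_of_exponent_ge (by linarith : 0 < 1 - t) (by linarith)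
          (by linarith : p - 1 ≤ 1)
    rw [Real.zero_rpow (by linarith), Real.zero_rpow (by linarith), sub_zero, h1]
    nlinarith
  rcases ht1.eq_or_lt with rfl | ht1'
  · -- `t = 1`
    rw [sub_self, Real.zero_rpow (by linarith), zero_mul, sub_zero, mul_one]
    have h1 : (1 - a) ^ 2 ≤ (1 - a) ^ p := by
      rcases hat.eq_or_lt with rfl | h
      · simp [Real.zero_rpow (by linarith : p ≠ 0)]
      · rw [← Real.rpow_two]
        exact Real.rpow_le_rpow_of_exponent_ge (by linarith) (by linarith) hp2.le
    have h2 : a ≤ a ^ (p / 2) := by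
      simpa using Real.rpow_le_rpow_of_exponent_ge ha0 hat (by linarith : p / 2 ≤ 1)
    have h3 : a ^ (p / 2) ≤ 1 := Real.rpow_le_one ha hat (by linarith)
    nlinarith
  have ha1 : a < 1 := by linarith
  have h2 : a ≤ a ^ (p / 2) := by
    simpa using Real.rpow_le_rpow_of_exponent_ge ha0 ha1.le (by linarith : p / 2 ≤ 1)
  have h3 : a ^ (p / 2) ≤ 1 := Real.rpow_le_one ha ha1.le (by linarith)
  have hsq : (a ^ (p / 2) - 1) ^ 2 ≤ (1 - a) ^ 2 := by nlinarith
  have hl : (1 - a) * (1 - a) ^ (p - 2) = (1 - a) ^ (p - 1) := by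
    rw [mul_comm, ← Real.rpow_add_one (by linarith)]; ring_nf
  have hl1 : 1 - a ≤ (1 - a) ^ (p - 1) := by
    simpa using Real.rpow_le_rpow_of_exponent_ge (by linarith : 0 < 1 - a) (by linarith)
      (by linarith : p - 1 ≤ 1)
  have hc1 : (1 - t) * (1 - a) ^ (p - 2) ≤ (1 - t) ^ (p - 1) := by
    have : (1 - t) ^ (p - 1) = (1 - t) * (1 - t) ^ (p - 2) := by
      rw [mul_comm, ← Real.rpow_add_one (by linarith)]; ring_nf
    rw [this]
    apply mul_le_mul_of_nonneg_left _ (by linarith)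
    exact Real.rpow_le_rpow_of_nonpos (by linarith) (by linarith) (by linarith)
  have hp' : a ^ p = a * a ^ (p - 1) := by
    rw [mul_comm, ← Real.rpow_add_one ha0.ne']; ring_nf
  have hb : a ^ (p - 1) ≤ 1 + (p - 1) * (a - 1) := rpow_le_tangent ha (by linarith) (by linarith)
  have hd : (t - a) + (p - 1) * (a * (1 - a)) ≤ t - a ^ p := by rw [hp']; nlinarith
  have hT : (t - a) * (1 - a) ^ (p - 1) ≤ (t - a) ^ p + (1 - t) ^ (p - 1) * (t - a) := by
    rcases hat.eq_or_lt with rfl | h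
    · simp [Real.zero_rpow (by linarith : p ≠ 0)]
    have e : (t - a) ^ p = (t - a) * (t - a) ^ (p - 1) := by
      rw [mul_comm, ← Real.rpow_add_one (by linarith)]; ring_nf
    have := Real.rpow_add_le_add_rpow (by linarith : 0 ≤ t - a) (by linarith : 0 ≤ 1 - t)
      (by linarith : 0 ≤ p - 1) (by linarith)
    rw [show t - a + (1 - t) = 1 - a by ring] at this
    rw [e]; nlinarith
  have hpos : 0 < (1 - t) ^ (p - 1) := Real.rpow_pos_of_pos (by linarith) _
  have hpos2 : 0 < (1 - a) ^ (p - 2) := Real.rpow_pos_of_pos (by linarith) _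
  calc (p - 1) * t * (a ^ (p / 2) - 1) ^ 2 ≤ (p - 1) * t * (1 - a) ^ 2 := by
        apply mul_le_mul_of_nonneg_left hsq; nlinarith
    _ = (1 - a) * ((p - 1) * (t * (1 - a))) := by ring
    _ ≤ (1 - a) ^ (p - 1) * ((p - 1) * (t * (1 - a))) := by
        apply mul_le_mul_of_nonneg_right hl1
        exact mul_nonneg (by linarith) (mul_nonneg ht0.le (by linarith))
    -- Here `t(1-a) = (t-a) + a(1-t)` and `p - 1 ≤ 1`.
    _ ≤ (1 - a) ^ (p - 1) * ((t - a) + (p - 1) * (a * (1 - t))) := by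
        apply mul_le_mul_of_nonneg_left _ (by linarith)
        nlinarith
    _ = (t - a) * (1 - a) ^ (p - 1) +
          (p - 1) * (a * (1 - a)) * ((1 - t) * (1 - a) ^ (p - 2)) := by
        rw [← hl]; ring
    _ ≤ ((t - a) ^ p + (1 - t) ^ (p - 1) * (t - a)) +
          (p - 1) * (a * (1 - a)) * (1 - t) ^ (p - 1) := by
        apply add_le_add hT
        apply mul_le_mul_of_nonneg_left hc1
        exact mul_nonneg (by linarith) (mul_nonneg ha (by linarith))
    _ = (t - a) ^ p + (1 - t) ^ (p - 1) * ((t - a) + (p - 1) * (a * (1 - a))) := by ring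
    _ ≤ (t - a) ^ p + (1 - t) ^ (p - 1) * (t - a ^ p) := by gcongr
    _ = _ := by ring

/-- From `2(p-1) ≤ 1 + (p-1)^2 ≤ 2^{p-1}`. -/
lemma sub_one_le_two_rpow {p : ℝ} (hp1 : 1 < p) (hp2 : p < 2) : p - 1 ≤ (2 : ℝ) ^ (p - 2) := by
  have h := one_add_sq_le_two_rpow (x := p - 1) ⟨by linarith, by linarith⟩
  have h2 : (2 : ℝ) ^ (p - 1) = 2 ^ (p - 2) * 2 := by
    rw [← Real.rpow_add_one two_ne_zero]; ring_nf
  nlinarith [sq_nonneg (p - 2)]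

/-- Because `b^p ≤ 1`, the second derivative in `t` of right minus left is decreasing, so the
dichotomy lemma applies. The slope at `0` is nonnegative since `b^{p/2} ≤ b^{p-1}`; the value at `1`
is midpoint concavity of `r^{p/2}` combined with `p - 1 ≤ 2^{p-2}`. -/
lemma gap_neg_of_le_one {p : ℝ} (hp1 : 1 < p) (hp2 : p < 2) {b t : ℝ} (hb : 0 < b) (hb1 : b ≤ 1)
    (ht : t ∈ Set.Icc (0 : ℝ) 1) :
    (p - 1) * t * (b ^ (p / 2) + 1) ^ 2 ≤ (b + t) ^ p - (1 - t) ^ (p - 1) * (b ^ p - t) := by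
  set k := (p - 1) * (b ^ (p / 2) + 1) ^ 2 with hk
  have hbp : b ^ p ≤ 1 := Real.rpow_le_one hb.le hb1 (by linarith)
  have key := nonneg_of_second_deriv_dichotomy
    (M := fun t => (b + 1 * t) ^ p - (1 - t) ^ (p - 1) * (b ^ p - t) - t * k)
    (M' := fun t => 1 * p * (b + 1 * t) ^ (p - 1) + (p - 1) * (1 - t) ^ (p - 2) * (b ^ p - 1)
        + p * (1 - t) ^ (p - 1) - k)
    (M'' := fun t => (p - 1) * (1 ^ 2 * p * (b + 1 * t) ^ (p - 2)
      + (2 - p) * (1 - t) ^ (p - 3) * (b ^ p - 1) - p * (1 - t) ^ (p - 2)))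
    (by
      refine ContinuousOn.sub (ContinuousOn.sub ?_ (ContinuousOn.mul ?_ ?_)) (by fun_prop)
      · exact ContinuousOn.rpow_const (by fun_prop) (fun x _ => Or.inr (by linarith))
      · exact ContinuousOn.rpow_const (by fun_prop) (fun x _ => Or.inr (by linarith))
      · fun_prop)
    (fun t ht => by
      have := (hasDerivAt_gap (a := b) (σ := 1) (q := b ^ p) p (by linarith [ht.1])
        (by linarith [ht.2] : 1 - t ≠ 0)).sub ((hasDerivAt_id t).mul_const k)
      exact this.congr_deriv (by ring))
    (fun t ht => by
      have := (hasDerivAt_deriv_gap (a := b) (σ := 1) (q := b ^ p) p (by linarith [ht.1])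
        (by linarith [ht.2] : 1 - t ≠ 0)).sub_const k
      exact this.congr_deriv (by ring))
    (Or.inr ⟨by
      have h1 : b ^ p = b * b ^ (p - 1) := by
        rw [mul_comm, ← Real.rpow_add_one hb.ne']; ring_nf
      have h2 : b ^ (p / 2) ≤ b ^ (p - 1) :=
        Real.rpow_le_rpow_of_exponent_ge hb hb1 (by linarith)
      have h3 := rpow_half_sq hb.le p
      have h4 : 0 < b ^ (p - 1) := by positivity
      simp only [mul_zero, add_zero, sub_zero, Real.one_rpow, mul_one, one_mul, hk]
      nlinarith,
      fun r t hr hrt ht1 => by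
        have h1 : (b + 1 * t) ^ (p - 2) ≤ (b + 1 * r) ^ (p - 2) :=
          Real.rpow_le_rpow_of_nonpos (by linarith) (by linarith) (by linarith)
        have h2 : (1 - r) ^ (p - 3) ≤ (1 - t) ^ (p - 3) :=
          Real.rpow_le_rpow_of_nonpos (by linarith) (by linarith) (by linarith)
        have h3 : (1 - r) ^ (p - 2) ≤ (1 - t) ^ (p - 2) :=
          Real.rpow_le_rpow_of_nonpos (by linarith) (by linarith) (by linarith)
        have h4 : (2 - p) * (1 - t) ^ (p - 3) * (b ^ p - 1) ≤
            (2 - p) * (1 - r) ^ (p - 3) * (b ^ p - 1) := by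
          apply mul_le_mul_of_nonpos_right _ (by linarith)
          exact mul_le_mul_of_nonneg_left h2 (by linarith)
        apply mul_le_mul_of_nonneg_left _ (by linarith)
        nlinarith⟩)
    (by simp)
    (by
      have h1 := (Real.concaveOn_rpow (by linarith : 0 ≤ p / 2) (by linarith)).2
        (Set.mem_Ici.2 hb.le) (Set.mem_Ici.2 zero_le_one) (by norm_num : (0 : ℝ) ≤ 1 / 2)
        (by norm_num : (0 : ℝ) ≤ 1 / 2) (by norm_num)
      simp only [smul_eq_mul, Real.one_rpow] at h1
      have h0 : 0 < b ^ (p / 2) := by positivity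
      have h2 : ((b ^ (p / 2) + 1) / 2) ^ 2 ≤ ((b + 1) / 2) ^ p := by
        rw [← rpow_half_sq (by positivity : 0 ≤ (b + 1) / 2)]
        apply pow_le_pow_left₀ (by positivity)
        calc _ = 1 / 2 * b ^ (p / 2) + 1 / 2 * 1 := by ring
          _ ≤ _ := h1
          _ = _ := by ring_nf
      rw [Real.div_rpow (by positivity) (by norm_num), div_pow] at h2
      have h3 := sub_one_le_two_rpow hp1 hp2
      rw [Real.rpow_sub two_pos, Real.rpow_two] at h3
      have h5 : (0 : ℝ) < 2 ^ p := by positivity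
      simp only [one_mul, sub_self, Real.zero_rpow (by linarith : p - 1 ≠ 0), zero_mul, sub_zero,
        sub_nonneg, hk]
      calc (p - 1) * (b ^ (p / 2) + 1) ^ 2 ≤ 2 ^ p / 2 ^ 2 * (b ^ (p / 2) + 1) ^ 2 := by
            apply mul_le_mul_of_nonneg_right h3 (by positivity)
        _ = (b ^ (p / 2) + 1) ^ 2 / 2 ^ 2 * 2 ^ p := by ring
        _ ≤ (b + 1) ^ p / 2 ^ p * 2 ^ p := by gcongr
        _ = _ := by field_simp) ht
  simp only [one_mul] at key
  rw [hk] at key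
  linarith

/-- Replaces `(1-t)^{p-1}` by its tangent at `t = 0`; the sign is right because `b^p ≥ 1 ≥ t`. -/
lemma gap_neg_of_one_le_aux {p : ℝ} (hp1 : 1 < p) (hp2 : p < 2) {b t : ℝ} (hb : 1 ≤ b)
    (ht : t ∈ Set.Icc (0 : ℝ) 1) :
    (b + t) ^ p - (1 - (p - 1) * t) * (b ^ p - t) ≤
      (b + t) ^ p - (1 - t) ^ (p - 1) * (b ^ p - t) := by
  have h1 : (1 - t) ^ (p - 1) ≤ 1 + (p - 1) * ((1 - t) - 1) :=
    rpow_le_tangent (by linarith [ht.2]) (by linarith) (by linarith)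
  have h2 : 1 ≤ b ^ p := Real.one_le_rpow hb (by linarith)
  have := ht.2
  nlinarith

/-- The tangent bound for `(b+t)^p` at `t = 0` leaves, up to a nonnegative multiple of `t(1-t)`, a
bound proportional to `t`. What remains is quadratic in `y = b^{p/2}` and follows from `((p-1)y -
1)^2 ≥ 0`. -/
lemma gap_neg_of_one_le_left {p : ℝ} (hp1 : 1 < p) (hp2 : p < 2) {b t : ℝ} (hb : 1 ≤ b)
    (ht : t ∈ Set.Icc (0 : ℝ) 1) :
    (p - 1) / p * t * (b ^ (p / 2) + 1) ^ 2 ≤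
      (b + t) ^ p - (1 - t) ^ (p - 1) * (b ^ p - t) := by
  refine le_trans ?_ (gap_neg_of_one_le_aux hp1 hp2 hb ht)
  obtain ⟨ht0, ht1⟩ := ht
  have hb0 : 0 < b := by linarith
  have e : b ^ p = b * b ^ (p - 1) := by
    rw [mul_comm, ← Real.rpow_add_one hb0.ne']; ring_nf
  have h1 : b ^ p + p * t * b ^ (p - 1) ≤ (b + t) ^ p := by
    have := tangent_le_rpow (x := (b + t) / b) (p := p) (by positivity) hp1.le
    rw [Real.div_rpow (by positivity) hb0.le, le_div_iff₀ (by positivity)] at this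
    calc _ = (1 + p * ((b + t) / b - 1)) * b ^ p := by
          rw [e]; field_simp; ring
      _ ≤ _ := this
  have h2 : 1 ≤ b ^ (p - 1) := Real.one_le_rpow hb (by linarith)
  have h3 := rpow_half_sq hb0.le p
  set y := b ^ (p / 2) with hy
  have h4 : (p - 1) / p * (y + 1) ^ 2 ≤ p * b ^ (p - 1) + 2 - p + (p - 1) * b ^ p := by
    rw [← h3, div_mul_eq_mul_div, div_le_iff₀ (by linarith)]
    nlinarith [sq_nonneg ((p - 1) * y - 1), mul_nonneg (sq_nonneg p) (sub_nonneg.2 h2)]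
  calc _ = t * ((p - 1) / p * (y + 1) ^ 2) := by ring
    _ ≤ t * (p * b ^ (p - 1) + 2 - p + (p - 1) * b ^ p) := by gcongr
    _ ≤ _ := by
      nlinarith [mul_nonneg (mul_nonneg (sub_nonneg.2 hp1.le) ht0) (sub_nonneg.2 ht1)]

/-- The endpoint `t = 1` of the inequality after the tangent replacement. The difference is
nonnegative at `b = 1`, by `1 + (p-1)^2 ≤ 2^{p-1}`, and does not decrease with `b`. -/
lemma gap_neg_right_end {p : ℝ} (hp1 : 1 < p) (hp2 : p < 2) {b : ℝ} (hb : 1 ≤ b) :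
    p * (p - 1) / 2 * (b ^ (p / 2) + 1) ^ 2 ≤ (b + 1) ^ p - (2 - p) * (b ^ p - 1) := by
  set C := p * (p - 1) / 2 with hC
  have h2x := one_add_sq_le_two_rpow (x := p - 1) ⟨by linarith, by linarith⟩
  have hC0 : 0 < C := by rw [hC]; nlinarith
  set R : ℝ → ℝ := fun b => (b + 1) ^ p - (2 - p) * (b ^ p - 1) - C * (b ^ p + 2 * b ^ (p / 2) + 1)
    with hR
  set R' : ℝ → ℝ := fun b => p * (b + 1) ^ (p - 1) - (2 - p) * (p * b ^ (p - 1))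
    - C * (p * b ^ (p - 1) + p * b ^ (p / 2 - 1)) with hR'
  have hd : ∀ x, 1 ≤ x → HasDerivAt R (R' x) x := fun x hx => by
    have e1 : ∀ q : ℝ, HasDerivAt (fun b : ℝ => b ^ q) (q * x ^ (q - 1)) x := fun q =>
      Real.hasDerivAt_rpow_const (Or.inl (by linarith))
    have e2 : HasDerivAt (fun b : ℝ => (b + 1) ^ p) (p * (x + 1) ^ (p - 1)) x := by
      simpa using ((hasDerivAt_id x).add_const 1).rpow_const (p := p) (Or.inr hp1.le)
    have := (e2.sub (((e1 p).sub_const 1).const_mul (2 - p))).sub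
      ((((e1 p).add ((e1 (p / 2)).const_mul 2)).add_const 1).const_mul C)
    refine this.congr_deriv ?_
    simp only [hR']; ring
  have hpos : ∀ x, 1 ≤ x → 0 ≤ R' x := fun x hx => by
    have x0 : 0 < x := by linarith
    set z := 1 / x with hz
    have hz0 : 0 < z := by positivity
    have hz1 : z ≤ 1 := by rw [hz, div_le_one x0]; exact hx
    have e1 : (x + 1) ^ (p - 1) = x ^ (p - 1) * (1 + z) ^ (p - 1) := by
      rw [← Real.mul_rpow x0.le (by positivity)]; congr 1; rw [hz]; field_simp
    have e2 : x ^ (p / 2 - 1) = x ^ (p - 1) * z ^ (p / 2) := by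
      rw [hz, Real.div_rpow zero_le_one x0.le, Real.one_rpow, mul_one_div, ← Real.rpow_sub x0]
      ring_nf
    have h1 : z ^ (p / 2) ≤ 1 + p / 2 * (z - 1) := rpow_le_tangent hz0.le (by linarith) (by linarith)
    have h2 : 1 + (2 ^ (p - 1) - 1) * z ≤ (1 + z) ^ (p - 1) := by
      have := (Real.concaveOn_rpow (by linarith : 0 ≤ p - 1) (by linarith)).2
        (Set.mem_Ici.2 (zero_le_one' ℝ)) (Set.mem_Ici.2 (zero_le_two (α := ℝ)))
        (by linarith : 0 ≤ 1 - z) hz0.le (by ring)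
      simp only [smul_eq_mul, Real.one_rpow] at this
      calc _ = (1 - z) * 1 + z * 2 ^ (p - 1) := by ring
        _ ≤ _ := this
        _ = _ := by ring_nf
    -- The chord bound for `(1+z)^{p-1}` and the tangent bound for `z^{p/2}` give a minorant affine
    -- in `z`. Its values are `(p-1)(1-p/2)^2` at `z = 0` and `2^{p-1} - 1 - (p-1)^2` at `z = 1`,
    -- both nonnegative.
    have hr : 0 ≤ (1 + z) ^ (p - 1) - (2 - p) - C - C * z ^ (p / 2) := by
      have h3 : C * z ^ (p / 2) ≤ C * (1 + p / 2 * (z - 1)) := by gcongr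
      have h4 : 0 ≤ (1 - z) * ((p - 1) * (1 - p / 2) ^ 2) := by
        apply mul_nonneg (by linarith); apply mul_nonneg (by linarith); positivity
      have h5 : 0 ≤ z * (2 ^ (p - 1) - 1 - (p - 1) ^ 2) := mul_nonneg hz0.le (by linarith)
      rw [hC] at h3 ⊢
      nlinarith
    have : R' x = p * x ^ (p - 1) * ((1 + z) ^ (p - 1) - (2 - p) - C - C * z ^ (p / 2)) := by
      simp only [hR']; rw [e1, e2]; ring
    rw [this]; positivity
  have hmono : R 1 ≤ R b := by
    rcases hb.eq_or_lt with h | h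
    · rw [h]
    obtain ⟨c, hc, hc'⟩ := exists_hasDerivAt_eq_slope R R' h
      (fun y hy => (hd y hy.1).continuousAt.continuousWithinAt) (fun y hy => hd y hy.1.le)
    have := hpos c hc.1.le
    rw [hc', div_nonneg_iff] at this
    rcases this with h' | h'
    · linarith [h'.1]
    · linarith [h'.2]
  have hR1 : 0 ≤ R 1 := by
    have e : (2 : ℝ) ^ p = 2 ^ (p - 1) * 2 := by
      rw [← Real.rpow_add_one two_ne_zero]; ring_nf
    simp only [hR, Real.one_rpow, hC]
    norm_num [e]
    nlinarith
  have := rpow_half_sq (by linarith : 0 ≤ b) p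
  have h6 := hR1.trans hmono
  simp only [hR] at h6
  rw [← this] at h6 ⊢
  linarith

/-- After the tangent replacement, right minus left is concave in `t` and vanishes at `0`;
`gap_neg_right_end` supplies the other endpoint. -/
lemma gap_neg_of_one_le_right {p : ℝ} (hp1 : 1 < p) (hp2 : p < 2) {b t : ℝ} (hb : 1 ≤ b)
    (ht : t ∈ Set.Icc (0 : ℝ) 1) :
    p * (p - 1) / 2 * t * (b ^ (p / 2) + 1) ^ 2 ≤
      (b + t) ^ p - (1 - t) ^ (p - 1) * (b ^ p - t) := by
  refine le_trans ?_ (gap_neg_of_one_le_aux hp1 hp2 hb ht)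
  have hend := gap_neg_right_end hp1 hp2 hb
  set k := p * (p - 1) / 2 * (b ^ (p / 2) + 1) ^ 2
  set l := 1 + (p - 1) * b ^ p - k with hl
  have e0 : ∀ x : ℝ, HasDerivAt (fun t : ℝ => b + t) 1 x := fun x => by
    simpa using (hasDerivAt_id x).const_add b
  have key := nonneg_of_second_deriv_dichotomy
    (M := fun t => (b + t) ^ p - b ^ p + t * l - (p - 1) * t ^ 2)
    (M' := fun t => p * (b + t) ^ (p - 1) + l - (p - 1) * (2 * t))
    (M'' := fun t => p * ((p - 1) * (b + t) ^ (p - 2)) - (p - 1) * 2)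
    (by
      refine ContinuousOn.sub (ContinuousOn.add (ContinuousOn.sub ?_ (by fun_prop)) (by fun_prop))
        (by fun_prop)
      exact ContinuousOn.rpow_const (by fun_prop) (fun x _ => Or.inr (by linarith)))
    (fun t ht => by
      have := ((((e0 t).rpow_const (p := p) (Or.inr hp1.le)).sub_const (b ^ p)).add
        ((hasDerivAt_id t).mul_const l)).sub ((hasDerivAt_pow 2 t).const_mul (p - 1))
      exact this.congr_deriv (by simp))
    (fun t ht => by
      have := ((((e0 t).rpow_const (p := p - 1) (Or.inl (by linarith [ht.1]))).const_mul
        p).add_const l).sub (((hasDerivAt_id t).const_mul 2).const_mul (p - 1))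
      exact this.congr_deriv (by
        rw [show p - 1 - 1 = p - 2 by ring]; ring))
    (Or.inl fun t ht => by
      have : (b + t) ^ (p - 2) ≤ 1 :=
        Real.rpow_le_one_of_one_le_of_nonpos (by linarith [ht.1]) (by linarith)
      have h0 : 0 < (b + t) ^ (p - 2) := Real.rpow_pos_of_pos (by linarith [ht.1]) _
      have : p * (b + t) ^ (p - 2) ≤ 2 := by nlinarith
      nlinarith)
    (by simp)
    (by simp only [hl]; linarith) ht
  simp only [hl] at key
  calc _ = t * k := by ring
    _ ≤ _ := by linarith

/-! ### Signed powers and the homogeneous form -/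

lemma frenchPow_of_nonneg {a k : ℝ} (hk : k ≠ 0) (ha : 0 ≤ a) : frenchPow a k = a ^ k := by
  unfold frenchPow
  rcases ha.eq_or_lt with rfl | h
  · simp [Real.zero_rpow hk]
  · rw [abs_of_nonneg ha, Real.sign_of_pos h, mul_one]

lemma frenchPow_neg (a k : ℝ) : frenchPow (-a) k = -frenchPow a k := by
  simp [frenchPow, Real.sign_neg]

lemma gap_of_nonneg {p : ℝ} (hp1 : 1 < p) (hp2 : p < 2) {a t : ℝ} (ha : 0 ≤ a)
    (ht : t ∈ Set.Icc (0 : ℝ) 1) :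
    (p - 1) * t * (frenchPow a (p / 2) - 1) ^ 2 ≤
      |a - t| ^ p - (1 - t) ^ (p - 1) * (|a| ^ p - t) := by
  obtain ⟨ht0, ht1⟩ := ht
  rw [frenchPow_of_nonneg (by linarith) ha]
  rcases ht0.eq_or_lt with rfl | ht0
  · simp
  rw [abs_of_nonneg ha]
  rcases le_or_gt a t with h | h
  · rw [abs_sub_comm, abs_of_nonneg (by linarith)]
    exact gap_of_le hp1 hp2 ha h ht1 ht0
  rw [abs_of_pos (by linarith)]
  rcases ht1.eq_or_lt with rfl | ht1
  -- At `t = 1` the inequality is invariant under `a ↦ 1/a` after multiplication by `a^p`, so `a >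
  -- 1` reduces to `gap_of_le`.
  · have h0 : 0 < a := by linarith
    have := gap_of_le hp1 hp2 (a := 1 / a) (t := 1) (by positivity)
      (by rw [div_le_one h0]; exact h.le) le_rfl one_pos
    have h1 : (1 - 1 / a) ^ p = (a - 1) ^ p / a ^ p := by
      rw [← Real.div_rpow (by linarith) h0.le]; congr 1; field_simp
    have h2 : (1 / a) ^ (p / 2) = 1 / a ^ (p / 2) := by
      rw [Real.div_rpow zero_le_one h0.le, Real.one_rpow]
    have h3 : 0 < a ^ (p / 2) := by positivity
    rw [h1, h2, sub_self, Real.zero_rpow (by linarith), zero_mul, sub_zero,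
      le_div_iff₀ (by positivity), ← rpow_half_sq h0.le p] at this
    rw [sub_self, Real.zero_rpow (by linarith), zero_mul, sub_zero]
    calc _ = (p - 1) * 1 * (1 / a ^ (p / 2) - 1) ^ 2 * (a ^ (p / 2)) ^ 2 := by
          field_simp; ring
      _ ≤ _ := this
  · exact gap_of_lt hp1 hp2 (by linarith) ht0 h ht1

lemma remainderConst_le {p : ℝ} (hp1 : 1 < p) (hp2 : p < 2) : remainderConst p ≤ p - 1 := by
  unfold remainderConst
  apply max_le
  · rw [div_le_iff₀ (by linarith)]; nlinarith
  · nlinarith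

lemma remainderConst_nonneg {p : ℝ} (hp1 : 1 < p) : 0 ≤ remainderConst p :=
  le_max_of_le_left (div_nonneg (by linarith) (by linarith))

lemma gap_of_real {p : ℝ} (hp1 : 1 < p) (hp2 : p < 2) (a : ℝ) {t : ℝ}
    (ht : t ∈ Set.Icc (0 : ℝ) 1) :
    remainderConst p * t * (frenchPow a (p / 2) - 1) ^ 2 ≤
      |a - t| ^ p - (1 - t) ^ (p - 1) * (|a| ^ p - t) := by
  rcases le_or_gt 0 a with ha | ha
  · refine le_trans ?_ (gap_of_nonneg hp1 hp2 ha ht)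
    have := ht.1
    have := remainderConst_le hp1 hp2
    gcongr
  obtain ⟨b, rfl⟩ : ∃ b, a = -b := ⟨-a, by ring⟩
  have hb : 0 < b := by linarith
  rw [frenchPow_neg, frenchPow_of_nonneg (by linarith) hb.le, abs_neg, abs_of_pos hb,
    show -b - t = -(b + t) by ring, abs_neg, abs_of_nonneg (by linarith [ht.1]),
    show (-b ^ (p / 2) - 1) ^ 2 = (b ^ (p / 2) + 1) ^ 2 by ring]
  rcases le_or_gt b 1 with hb1 | hb1
  · refine le_trans ?_ (gap_neg_of_le_one hp1 hp2 hb hb1 ht)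
    have := ht.1
    have := remainderConst_le hp1 hp2
    gcongr
  · unfold remainderConst
    rcases max_choice ((p - 1) / p) (p * (p - 1) / 2) with h | h <;> rw [h]
    · exact gap_neg_of_one_le_left hp1 hp2 hb1.le ht
    · exact gap_neg_of_one_le_right hp1 hp2 hb1.le ht

/-- The homogeneous two-weight form of the pointwise inequality. -/
lemma weighted_gap {p C : ℝ} (hp1 : 1 < p) (hp2 : p < 2) (hC : C ≤ p - 1) {S : Set ℝ}
    (hS : ∀ A ∈ S, ∀ B ∈ S, B ≠ 0 → ∀ t ∈ Set.Icc (0 : ℝ) 1,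
      C * t * (frenchPow (A / B) (p / 2) - 1) ^ 2 ≤
        |A / B - t| ^ p - (1 - t) ^ (p - 1) * (|A / B| ^ p - t))
    {A B m M : ℝ} (hA : A ∈ S) (hB : B ∈ S) (hm : 0 < m) (hmM : m ≤ M) :
    (M - m) ^ (p - 1) * (M * |A| ^ p) +
        C * ((frenchPow A (p / 2) - frenchPow B (p / 2)) ^ 2 * (m * M ^ (p - 1))) ≤
      |M * A - m * B| ^ p + (M - m) ^ (p - 1) * (m * |B| ^ p) := by
  have hM : 0 < M := by linarith
  set t := m / M with ht
  have ht0 : 0 < t := by positivity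
  have ht1 : t ≤ 1 := by rw [ht, div_le_one hM]; exact hmM
  have hmt : m = M * t := by rw [ht]; field_simp
  have eM : M ^ p = M * M ^ (p - 1) := by
    rw [mul_comm, ← Real.rpow_add_one hM.ne']; ring_nf
  have e1 : (M - m) ^ (p - 1) = M ^ (p - 1) * (1 - t) ^ (p - 1) := by
    rw [← Real.mul_rpow hM.le (by linarith)]; congr 1; rw [hmt]; ring
  have e2 : |M * A - m * B| ^ p = M * M ^ (p - 1) * |A - t * B| ^ p := by
    rw [← eM, ← abs_of_pos hM, ← Real.mul_rpow (abs_nonneg _) (abs_nonneg _), ← abs_mul,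
      abs_of_pos hM]
    congr 2; rw [hmt]; ring
  suffices h : (1 - t) ^ (p - 1) * |A| ^ p + C * t * (frenchPow A (p / 2) - frenchPow B (p / 2)) ^ 2
      ≤ |A - t * B| ^ p + (1 - t) ^ (p - 1) * (t * |B| ^ p) by
    have h' := mul_le_mul_of_nonneg_left h (by positivity : 0 ≤ M * M ^ (p - 1))
    rw [e1, e2]
    calc _ = M * M ^ (p - 1) * ((1 - t) ^ (p - 1) * |A| ^ p +
          C * t * (frenchPow A (p / 2) - frenchPow B (p / 2)) ^ 2) := by rw [hmt]; ring
      _ ≤ _ := h'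
      _ = _ := by rw [hmt]; ring
  have hsq : ∀ a : ℝ, frenchPow a (p / 2) ^ 2 = |a| ^ p := fun a => by
    unfold frenchPow
    rw [mul_pow, rpow_half_sq (abs_nonneg a)]
    rcases lt_trichotomy a 0 with h | rfl | h
    · rw [Real.sign_of_neg h]; norm_num
    · simp [Real.zero_rpow (by linarith : p ≠ 0)]
    · rw [Real.sign_of_pos h]; norm_num
  -- There is no ratio when `B = 0`; the claim becomes `(1-t)^{p-1} + C t ≤ 1`, which is where `C ≤
  -- p - 1` is needed.
  by_cases hB0 : B = 0
  · subst hB0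
    have h1 : (1 - t) ^ (p - 1) ≤ 1 + (p - 1) * ((1 - t) - 1) :=
      rpow_le_tangent (by linarith) (by linarith) (by linarith)
    have h2 : frenchPow 0 (p / 2) = 0 := by simp [frenchPow]
    rw [h2, sub_zero, hsq]
    simp only [mul_zero, sub_zero, abs_zero, Real.zero_rpow (by linarith : p ≠ 0), add_zero]
    have h3 : 0 ≤ |A| ^ p := by positivity
    have h4 : C * t ≤ (p - 1) * t := by gcongr
    nlinarith
  · have h := hS A hA B hB hB0 t ⟨ht0.le, ht1⟩
    have hB' : 0 < |B| := abs_pos.2 hB0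
    have e3 : |A| ^ p = |A / B| ^ p * |B| ^ p := by
      rw [← Real.mul_rpow (abs_nonneg _) hB'.le, ← abs_mul, div_mul_cancel₀ _ hB0]
    have e4 : |A - t * B| ^ p = |A / B - t| ^ p * |B| ^ p := by
      rw [← Real.mul_rpow (abs_nonneg _) hB'.le, ← abs_mul]; congr 2; field_simp
    have e5 : frenchPow A (p / 2) = frenchPow (A / B) (p / 2) * frenchPow B (p / 2) := by
      unfold frenchPow
      rw [abs_div, Real.div_rpow (abs_nonneg _) hB'.le]
      have : 0 < |B| ^ (p / 2) := by positivity
      have hs : Real.sign A = Real.sign (A / B) * Real.sign B := by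
        rcases lt_trichotomy A 0 with a | rfl | a
        · rcases lt_or_gt_of_ne hB0 with b | b
          · rw [Real.sign_of_neg a, Real.sign_of_neg b, Real.sign_of_pos (div_pos_of_neg_of_neg a b)]
            norm_num
          · rw [Real.sign_of_neg a, Real.sign_of_pos b, Real.sign_of_neg (div_neg_of_neg_of_pos a b)]
            norm_num
        · simp
        · rcases lt_or_gt_of_ne hB0 with b | b
          · rw [Real.sign_of_pos a, Real.sign_of_neg b, Real.sign_of_neg (div_neg_of_pos_of_neg a b)]
            norm_num
          · rw [Real.sign_of_pos a, Real.sign_of_pos b, Real.sign_of_pos (div_pos a b)]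
            norm_num
      rw [hs]; field_simp
    rw [e3, e4, e5]
    have h6 := mul_le_mul_of_nonneg_right h (by positivity : 0 ≤ |B| ^ p)
    have h7 : (frenchPow (A / B) (p / 2) * frenchPow B (p / 2) - frenchPow B (p / 2)) ^ 2 =
        (frenchPow (A / B) (p / 2) - 1) ^ 2 * |B| ^ p := by rw [← hsq B]; ring
    rw [h7]
    linarith

/-! ### Integrating the kernel over hyperplanes -/

/-- A nonzero Bochner integral certifies integrability, because the default value is `0`. Closed
formulas with positive value therefore transfer to the lower integral for free. -/
lemma lintegral_ofReal_eq_of_integral_ne_zero {X : Type*} [MeasurableSpace X] {μ : Measure X}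
    {f : X → ℝ} (hf : 0 ≤ᵐ[μ] f) (h : ∫ x, f x ∂μ ≠ 0) :
    ∫⁻ x, ENNReal.ofReal (f x) ∂μ = ENNReal.ofReal (∫ x, f x ∂μ) :=
  (ofReal_integral_eq_lintegral_ofReal (Integrable.of_integral_ne_zero h) hf).symm

lemma lintegral_Ioi_rpow_mul_exp {a r : ℝ} (ha : 0 < a) (hr : 0 < r) :
    ∫⁻ t in Set.Ioi (0 : ℝ), ENNReal.ofReal (t ^ (a - 1) * Real.exp (-(r * t))) =
      ENNReal.ofReal (r ^ (-a) * Real.Gamma a) := by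
  have h := Real.integral_rpow_mul_exp_neg_mul_Ioi ha hr
  have hG := Real.Gamma_pos_of_pos ha
  have hpos : 0 < (1 / r) ^ a * Real.Gamma a := by positivity
  rw [lintegral_ofReal_eq_of_integral_ne_zero _ (by rw [h]; exact hpos.ne'), h]
  · rw [one_div, Real.inv_rpow hr.le, Real.rpow_neg hr.le]
  · filter_upwards [ae_restrict_mem measurableSet_Ioi] with t ht
    have : (0 : ℝ) < t := ht
    simp only [Pi.zero_apply]; positivity

/-- The constant arising from integrating the kernel over the hyperplanes parallel to the
boundary. -/
noncomputable def sliceConst (n : ℕ) (q : ℝ) : ℝ :=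
  Real.pi ^ ((n : ℝ) / 2) * Real.Gamma ((q - n) / 2) / Real.Gamma (q / 2)

lemma sliceConst_pos {n : ℕ} {q : ℝ} (hq : (n : ℝ) < q) : 0 < sliceConst n q := by
  have h1 := Real.Gamma_pos_of_pos (s := (q - n) / 2) (by linarith)
  have h2 := Real.Gamma_pos_of_pos (s := q / 2) (by
    have : (0 : ℝ) ≤ n := n.cast_nonneg
    linarith)
  unfold sliceConst; positivity

/-- The power is a Gamma integral of Gaussians; after exchanging the integrals, the Gaussian in `z`
and a second Gamma integral are explicit. -/
lemma lintegral_norm_sq_add_sq_rpow {n : ℕ} {q ρ : ℝ} (hq : (n : ℝ) < q) (hρ : 0 < ρ) :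
    ∫⁻ z : EuclideanSpace ℝ (Fin n), ENNReal.ofReal ((‖z‖ ^ 2 + ρ ^ 2) ^ (-(q / 2))) =
      ENNReal.ofReal (sliceConst n q * ρ ^ (-(q - n))) := by
  have hn : (0 : ℝ) ≤ n := n.cast_nonneg
  have hq2 : 0 < q / 2 := by linarith
  have hG := Real.Gamma_pos_of_pos hq2
  have hG2 := Real.Gamma_pos_of_pos (s := (q - n) / 2) (by linarith)
  have e1 : ∀ z : EuclideanSpace ℝ (Fin n), ENNReal.ofReal ((‖z‖ ^ 2 + ρ ^ 2) ^ (-(q / 2))) =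
      ENNReal.ofReal (Real.Gamma (q / 2))⁻¹ * ∫⁻ t in Set.Ioi (0 : ℝ),
        ENNReal.ofReal (t ^ (q / 2 - 1) * Real.exp (-((‖z‖ ^ 2 + ρ ^ 2) * t))) := fun z => by
    rw [lintegral_Ioi_rpow_mul_exp hq2 (by positivity), ← ENNReal.ofReal_mul (by positivity)]
    congr 1; field_simp
  simp_rw [e1]
  rw [lintegral_const_mul' _ _ ENNReal.ofReal_ne_top, lintegral_lintegral_swap (by
    apply Measurable.aemeasurable; unfold Function.uncurry; fun_prop)]
  have e2 : ∀ t ∈ Set.Ioi (0 : ℝ), ∫⁻ z : EuclideanSpace ℝ (Fin n),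
      ENNReal.ofReal (t ^ (q / 2 - 1) * Real.exp (-((‖z‖ ^ 2 + ρ ^ 2) * t))) =
      ENNReal.ofReal (Real.pi ^ ((n : ℝ) / 2)) *
        ENNReal.ofReal (t ^ ((q - n) / 2 - 1) * Real.exp (-(ρ ^ 2 * t))) := fun t ht => by
    have ht0 : (0 : ℝ) < t := ht
    have hg := GaussianFourier.integral_rexp_neg_mul_sq_norm (V := EuclideanSpace ℝ (Fin n)) ht0
    rw [finrank_euclideanSpace_fin] at hg
    have hpos : 0 < (Real.pi / t) ^ ((n : ℝ) / 2) := by positivity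
    have := lintegral_ofReal_eq_of_integral_ne_zero (μ := volume)
      (f := fun v : EuclideanSpace ℝ (Fin n) => Real.exp (-t * ‖v‖ ^ 2))
      (Filter.Eventually.of_forall fun v => by simp only [Pi.zero_apply]; positivity)
      (by rw [hg]; exact hpos.ne')
    rw [hg] at this
    have e3 : ∀ z : EuclideanSpace ℝ (Fin n),
        ENNReal.ofReal (t ^ (q / 2 - 1) * Real.exp (-((‖z‖ ^ 2 + ρ ^ 2) * t))) =
        ENNReal.ofReal (t ^ (q / 2 - 1) * Real.exp (-(ρ ^ 2 * t))) *
          ENNReal.ofReal (Real.exp (-t * ‖z‖ ^ 2)) := fun z => by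
      rw [← ENNReal.ofReal_mul (by positivity), mul_assoc, ← Real.exp_add]; ring_nf
    simp_rw [e3]
    rw [lintegral_const_mul' _ _ ENNReal.ofReal_ne_top, this, ← ENNReal.ofReal_mul (by positivity),
      ← ENNReal.ofReal_mul (by positivity)]
    congr 1
    rw [Real.div_rpow Real.pi_pos.le ht0.le,
      show (q - n) / 2 - 1 = (q / 2 - 1) - n / 2 by ring, Real.rpow_sub ht0 (q / 2 - 1)]
    ring
  rw [setLIntegral_congr_fun measurableSet_Ioi e2, lintegral_const_mul' _ _ ENNReal.ofReal_ne_top,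
    lintegral_Ioi_rpow_mul_exp (by linarith) (by positivity), ← ENNReal.ofReal_mul (by positivity),
    ← ENNReal.ofReal_mul (by positivity)]
  congr 1
  have : (ρ ^ 2) ^ (-((q - n) / 2)) = ρ ^ (-(q - n)) := by
    rw [← Real.rpow_natCast, ← Real.rpow_mul hρ.le]; congr 1; push_cast; ring
  rw [this]; unfold sliceConst; ring

/-- The point with last coordinate `r` and remaining coordinates `z`. -/
noncomputable def slicePoint {n : ℕ} (r : ℝ) (z : EuclideanSpace ℝ (Fin n)) : EuclideanSpace ℝ (Fin (n + 1)) :=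
  WithLp.toLp 2 (Fin.insertNth (α := fun _ => ℝ) (Fin.last n) r z.ofLp)

@[simp] lemma slicePoint_last {n : ℕ} (r : ℝ) (z : EuclideanSpace ℝ (Fin n)) :
    slicePoint r z (Fin.last n) = r := by
  simp [slicePoint]

lemma norm_slicePoint_sub_sq {n : ℕ} (r r' : ℝ) (z z' : EuclideanSpace ℝ (Fin n)) :
    ‖slicePoint r z - slicePoint r' z'‖ ^ 2 = ‖z - z'‖ ^ 2 + (r - r') ^ 2 := by
  rw [EuclideanSpace.norm_sq_eq, EuclideanSpace.norm_sq_eq, Fin.sum_univ_succAbove _ (Fin.last n)]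
  simp only [slicePoint, PiLp.sub_apply, Fin.insertNth_apply_same, Fin.insertNth_apply_succAbove,
    Real.norm_eq_abs, sq_abs]
  ring

lemma lintegral_slice {n : ℕ} (F : EuclideanSpace ℝ (Fin (n + 1)) → ENNReal) (hF : Measurable F) :
    ∫⁻ x, F x = ∫⁻ r : ℝ, ∫⁻ z : EuclideanSpace ℝ (Fin n), F (slicePoint r z) := by
  have h1 := (PiLp.volume_preserving_toLp (Fin (n + 1))).lintegral_comp hF
  have h2 := ((volume_preserving_piFinSuccAbove (fun _ : Fin (n + 1) => ℝ)
    (Fin.last n)).symm).lintegral_comp (f := fun y => F (WithLp.toLp 2 y)) (by fun_prop)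
  have hins := (MeasurableEquiv.piFinSuccAbove (fun _ : Fin (n + 1) => ℝ) (Fin.last n)).symm.measurable
  rw [← h1, ← h2, Measure.volume_eq_prod, lintegral_prod]
  · refine lintegral_congr fun r => ?_
    exact ((PiLp.volume_preserving_ofLp (Fin n)).lintegral_comp
      (f := fun y => F (WithLp.toLp 2 (Fin.insertNth (α := fun _ => ℝ) (Fin.last n) r y)))
      (hF.comp ((WithLp.measurable_toLp 2 _).comp (hins.comp measurable_prodMk_left)))).symm
  · exact (hF.comp ((WithLp.measurable_toLp 2 _).comp hins)).aemeasurable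

lemma exists_eq_slicePoint {n : ℕ} (x : EuclideanSpace ℝ (Fin (n + 1))) :
    ∃ z, x = slicePoint (x (Fin.last n)) z := by
  refine ⟨WithLp.toLp 2 (fun i => x ((Fin.last n).succAbove i)), ?_⟩
  ext i
  refine Fin.succAboveCases (Fin.last n) ?_ (fun j => ?_) i <;> simp [slicePoint]

/-- Fubini in the last coordinate. Translation invariance removes the tangential part of `x`, and
the slice through `x`, where `ρ = 0`, is negligible. -/
lemma lintegral_kernel_slice {n : ℕ} {q : ℝ} (hq : (n : ℝ) < q) (φ : ℝ → ENNReal)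
    (hφ : Measurable φ) (x : EuclideanSpace ℝ (Fin (n + 1))) :
    ∫⁻ y : EuclideanSpace ℝ (Fin (n + 1)),
        φ (y (Fin.last n)) * ENNReal.ofReal (‖x - y‖ ^ (-q)) =
      ENNReal.ofReal (sliceConst n q) *
        ∫⁻ r : ℝ, φ r * ENNReal.ofReal (|x (Fin.last n) - r| ^ (-(q - n))) := by
  rw [lintegral_slice _ (by fun_prop), ← lintegral_const_mul' _ _ ENNReal.ofReal_ne_top]
  have hae : ∀ᵐ r : ℝ, r ≠ x (Fin.last n) := Measure.ae_ne volume _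
  refine lintegral_congr_ae ?_
  filter_upwards [hae] with r hr
  obtain ⟨z₀, hz₀⟩ := exists_eq_slicePoint x
  set h := x (Fin.last n)
  have hρ : 0 < |h - r| := abs_pos.2 (sub_ne_zero.2 hr.symm)
  have e : ∀ z : EuclideanSpace ℝ (Fin n), φ (slicePoint r z (Fin.last n)) *
      ENNReal.ofReal (‖x - slicePoint r z‖ ^ (-q)) =
      φ r * ENNReal.ofReal ((‖z₀ - z‖ ^ 2 + |h - r| ^ 2) ^ (-(q / 2))) := fun z => by
    rw [slicePoint_last, hz₀, sq_abs, ← norm_slicePoint_sub_sq, ← Real.rpow_natCast,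
      ← Real.rpow_mul (norm_nonneg _)]
    congr 4; push_cast; ring
  simp_rw [e]
  rw [lintegral_const_mul _ (by fun_prop),
    lintegral_sub_left_eq_self (fun z => ENNReal.ofReal ((‖z‖ ^ 2 + |h - r| ^ 2) ^ (-(q / 2)))) z₀,
    lintegral_norm_sq_add_sq_rpow hq hρ, ENNReal.ofReal_mul (sliceConst_pos hq).le]
  ring

/-! ### The one-dimensional integrals and the constant `𝒟` -/

/-- The integrand in `hardyConst`, with `g = (1 + α + β - sp) / p`. -/
noncomputable def profile (s p α β g t : ℝ) : ℝ :=
  (t ^ α + t ^ β) * |1 - t ^ (-g)| ^ p / (1 - t) ^ (1 + s * p)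

/-- The flux integrand, with exponent `p - 1` in place of `p`. -/
noncomputable def fluxProfile (s p α β g t : ℝ) : ℝ :=
  (t ^ α + t ^ β) * |1 - t ^ (-g)| ^ (p - 1) / (1 - t) ^ (1 + s * p)

lemma measurable_profile (s p α β g : ℝ) : Measurable (profile s p α β g) := by
  unfold profile; fun_prop

lemma measurable_fluxProfile (s p α β g : ℝ) : Measurable (fluxProfile s p α β g) := by
  unfold fluxProfile; fun_prop

lemma rpow_le_two_rpow_abs {c : ℝ} (hc : 1 / 2 ≤ c) (hc1 : c ≤ 1) (e : ℝ) : c ^ e ≤ 2 ^ |e| := by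
  have c0 : 0 < c := by linarith
  calc c ^ e ≤ c ^ (-|e|) := Real.rpow_le_rpow_of_exponent_ge c0 hc1 (neg_abs_le e)
    _ ≤ (1 / 2) ^ (-|e|) :=
        Real.rpow_le_rpow_of_nonpos (by norm_num) hc (neg_nonpos.2 (abs_nonneg e))
    _ = 2 ^ |e| := by rw [Real.rpow_neg (by norm_num), one_div, Real.inv_rpow (by norm_num), inv_inv]

lemma abs_one_sub_rpow_le {t : ℝ} (ht : 1 / 2 ≤ t) (ht1 : t < 1) (g : ℝ) :
    |1 - t ^ (-g)| ≤ |g| * 2 ^ |-g - 1| * (1 - t) := by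
  have hd : ∀ x ∈ Set.Icc t 1, HasDerivAt (fun x : ℝ => x ^ (-g)) (-g * x ^ (-g - 1)) x :=
    fun x hx => Real.hasDerivAt_rpow_const (Or.inl (by linarith [hx.1]))
  obtain ⟨c, hc, hc'⟩ := exists_hasDerivAt_eq_slope (fun x : ℝ => x ^ (-g)) _ ht1
    (fun x hx => (hd x hx).continuousAt.continuousWithinAt)
    (fun x hx => hd x ⟨hx.1.le, hx.2.le⟩)
  rw [eq_div_iff (by linarith), Real.one_rpow] at hc'
  rw [← hc', abs_mul, abs_mul, abs_neg, abs_of_pos (by linarith : 0 < 1 - t)]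
  have := rpow_le_two_rpow_abs (ht.trans hc.1.le) hc.2.le (-g - 1)
  rw [abs_of_pos (Real.rpow_pos_of_pos (by linarith [hc.1]) _)]
  have : 0 ≤ 1 - t := by linarith
  gcongr

lemma integrableOn_rpow_Ioo {e : ℝ} (he : -1 < e) :
    IntegrableOn (fun t : ℝ => t ^ e) (Set.Ioo 0 1) :=
  (intervalIntegrable_iff_integrableOn_Ioo_of_le zero_le_one).1
    (intervalIntegral.intervalIntegrable_rpow' he)

lemma integrableOn_one_sub_rpow_Ioo {e : ℝ} (he : -1 < e) :
    IntegrableOn (fun t : ℝ => (1 - t) ^ e) (Set.Ioo 0 1) := by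
  have := (intervalIntegral.intervalIntegrable_rpow' (a := 0) (b := 1) he).comp_sub_left 1
  simp only [sub_zero, sub_self] at this
  exact (intervalIntegrable_iff_integrableOn_Ioo_of_le zero_le_one).1 this.symm

lemma profile_nonneg {s p α β g t : ℝ} (ht : t ∈ Set.Ioo (0 : ℝ) 1) :
    0 ≤ profile s p α β g t := by
  have h0 := ht.1
  have h1 : 0 < 1 - t := by linarith [ht.2]
  unfold profile; positivity

lemma fluxProfile_nonneg {s p α β g t : ℝ} (ht : t ∈ Set.Ioo (0 : ℝ) 1) :
    0 ≤ fluxProfile s p α β g t := by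
  have h0 := ht.1
  have h1 : 0 < 1 - t := by linarith [ht.2]
  unfold fluxProfile; positivity

lemma one_sub_rpow_ne_zero {g t : ℝ} (hg : g ≠ 0) (ht : t ∈ Set.Ioo (0 : ℝ) 1) :
    1 - t ^ (-g) ≠ 0 := by
  intro h
  have h1 : t ^ (-g) = 1 := by linarith
  rcases lt_or_gt_of_ne hg with h0 | h0
  · exact (Real.rpow_lt_one ht.1.le ht.2 (by linarith : 0 < -g)).ne h1
  · exact (Real.one_lt_rpow_of_pos_of_lt_one_of_neg ht.1 ht.2 (by linarith)).ne' h1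

/-- Near `0` the singular part is `t^α t^{-gp} = t^{sp-1-β}`, integrable since `β < sp`, and
likewise with `α`, `β` exchanged. Near `1` the numerator is `O((1-t)^p)`, leaving the exponent
`p-1-sp > -1` because `s < 1`. -/
lemma integrableOn_profile {s p α β g : ℝ} (hs0 : 0 < s) (hs1 : s < 1) (hp1 : 1 < p)
    (hα : α ∈ Set.Ioo (-1) (s * p)) (hβ : β ∈ Set.Ioo (-1) (s * p))
    (hg : g * p = 1 + α + β - s * p) :
    IntegrableOn (profile s p α β g) (Set.Ioo 0 1) := by
  have hsp : 0 < s * p := by nlinarith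
  set c1 : ℝ := 2 ^ (1 + s * p)
  set K : ℝ := (2 ^ |α| + 2 ^ |β|) * (|g| * 2 ^ |-g - 1|) ^ p
  have hdom : IntegrableOn (fun t : ℝ => c1 * ((t ^ α + t ^ β) + (t ^ (s * p - 1 - β) +
      t ^ (s * p - 1 - α))) + K * (1 - t) ^ (p - (1 + s * p))) (Set.Ioo 0 1) := by
    refine Integrable.add (Integrable.const_mul (((integrableOn_rpow_Ioo hα.1).add
      (integrableOn_rpow_Ioo hβ.1)).add ((integrableOn_rpow_Ioo ?_).add
      (integrableOn_rpow_Ioo ?_))) c1) (Integrable.const_mul (integrableOn_one_sub_rpow_Ioo ?_) K)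
    · linarith [hβ.2]
    · linarith [hα.2]
    · nlinarith
  refine Integrable.mono' hdom (measurable_profile ..).aestronglyMeasurable ?_
  filter_upwards [ae_restrict_mem measurableSet_Ioo] with t ht
  rw [Real.norm_of_nonneg (profile_nonneg ht)]
  have h0 : 0 < t := ht.1
  have h1 : 0 < 1 - t := by linarith [ht.2]
  unfold profile
  rcases le_or_gt t (1 / 2) with hh | hh
  · have e1 : |1 - t ^ (-g)| ^ p ≤ 1 + t ^ (-(g * p)) := by
      have hz : 0 < t ^ (-g) := by positivity
      rcases le_or_gt (t ^ (-g)) 1 with h | h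
      · have : |1 - t ^ (-g)| ^ p ≤ 1 :=
          Real.rpow_le_one (abs_nonneg _) (by rw [abs_of_nonneg] <;> linarith) (by linarith)
        have : 0 < t ^ (-(g * p)) := by positivity
        linarith
      · have : |1 - t ^ (-g)| ^ p ≤ (t ^ (-g)) ^ p := by
          apply Real.rpow_le_rpow (abs_nonneg _) _ (by linarith)
          rw [abs_of_nonpos] <;> linarith
        rw [← Real.rpow_mul h0.le, neg_mul] at this
        linarith
    have e2 : 1 / (1 - t) ^ (1 + s * p) ≤ c1 := by
      have : (1 - t) ^ (-(1 + s * p)) ≤ (1 / 2) ^ (-(1 + s * p)) :=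
        Real.rpow_le_rpow_of_nonpos (by norm_num) (by linarith) (by linarith)
      rw [Real.rpow_neg h1.le, Real.rpow_neg (by norm_num), one_div (2 : ℝ),
        Real.inv_rpow (by norm_num), inv_inv] at this
      simpa using this
    have e3 : t ^ α * t ^ (-(g * p)) = t ^ (s * p - 1 - β) := by
      rw [← Real.rpow_add h0]; congr 1; linarith
    have e4 : t ^ β * t ^ (-(g * p)) = t ^ (s * p - 1 - α) := by
      rw [← Real.rpow_add h0]; congr 1; linarith
    calc _ = 1 / (1 - t) ^ (1 + s * p) * ((t ^ α + t ^ β) * |1 - t ^ (-g)| ^ p) := by ring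
      _ ≤ c1 * ((t ^ α + t ^ β) * (1 + t ^ (-(g * p)))) := by gcongr
      _ = c1 * ((t ^ α + t ^ β) + (t ^ (s * p - 1 - β) + t ^ (s * p - 1 - α))) := by
          rw [← e3, ← e4]; ring
      _ ≤ _ := by
          have : 0 ≤ K * (1 - t) ^ (p - (1 + s * p)) := by positivity
          linarith
  · have e1 : |1 - t ^ (-g)| ^ p ≤ (|g| * 2 ^ |-g - 1|) ^ p * (1 - t) ^ p := by
      rw [← Real.mul_rpow (by positivity) h1.le]
      exact Real.rpow_le_rpow (abs_nonneg _) (abs_one_sub_rpow_le hh.le ht.2 g) (by linarith)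
    have e2 := rpow_le_two_rpow_abs hh.le ht.2.le α
    have e3 := rpow_le_two_rpow_abs hh.le ht.2.le β
    calc _ ≤ (2 ^ |α| + 2 ^ |β|) * ((|g| * 2 ^ |-g - 1|) ^ p * (1 - t) ^ p) /
          (1 - t) ^ (1 + s * p) := by gcongr
      _ = K * (1 - t) ^ (p - (1 + s * p)) := by rw [Real.rpow_sub h1]; ring
      _ ≤ _ := by
          have : 0 ≤ c1 * ((t ^ α + t ^ β) + (t ^ (s * p - 1 - β) + t ^ (s * p - 1 - α))) := by
            positivity
          linarith

lemma hardyConst_eq (n : ℕ) (s p α β : ℝ) : hardyConst (n + 1) s p α β =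
    sliceConst n ((n + 1 : ℕ) + s * p) *
      ∫ t in Set.Ioo (0 : ℝ) 1, profile s p α β ((1 + α + β - s * p) / p) t := by
  unfold hardyConst sliceConst
  rw [intervalIntegral.integral_of_le zero_le_one, integral_Ioc_eq_integral_Ioo]
  congr 2
  push_cast
  ring_nf

lemma hardyConst_pos {n : ℕ} {s p α β : ℝ} (hs0 : 0 < s) (hs1 : s < 1) (hp1 : 1 < p)
    (hα : α ∈ Set.Ioo (-1) (s * p)) (hβ : β ∈ Set.Ioo (-1) (s * p)) (hne : 1 + α + β ≠ s * p) :
    0 < hardyConst (n + 1) s p α β := by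
  have hsp : 0 < s * p := by nlinarith
  have hp0 : p ≠ 0 := by linarith
  rw [hardyConst_eq]
  refine mul_pos (sliceConst_pos (by push_cast; linarith)) ?_
  have hint := integrableOn_profile hs0 hs1 hp1 hα hβ
    (div_mul_cancel₀ (1 + α + β - s * p) hp0)
  rw [setIntegral_pos_iff_support_of_nonneg_ae _ hint]
  · have : Set.Ioo (0 : ℝ) 1 ⊆
        Function.support (profile s p α β ((1 + α + β - s * p) / p)) ∩ Set.Ioo 0 1 := by
      refine fun t ht => ⟨?_, ht⟩
      have h0 := ht.1
      have h1 : 0 < 1 - t := by linarith [ht.2]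
      have := one_sub_rpow_ne_zero (g := (1 + α + β - s * p) / p)
        (div_ne_zero (sub_ne_zero.2 hne) hp0) ht
      rw [Function.mem_support]
      unfold profile
      positivity
    refine lt_of_lt_of_le ?_ (measure_mono this)
    simp
  · filter_upwards [ae_restrict_mem measurableSet_Ioo] with t ht using profile_nonneg ht

lemma ofReal_hardyConst {n : ℕ} {s p α β : ℝ} (hs0 : 0 < s) (hs1 : s < 1) (hp1 : 1 < p)
    (hα : α ∈ Set.Ioo (-1) (s * p)) (hβ : β ∈ Set.Ioo (-1) (s * p)) :
    ENNReal.ofReal (hardyConst (n + 1) s p α β) =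
      ENNReal.ofReal (sliceConst n ((n + 1 : ℕ) + s * p)) * ∫⁻ t in Set.Ioo (0 : ℝ) 1,
        ENNReal.ofReal (profile s p α β ((1 + α + β - s * p) / p) t) := by
  have hsp : 0 < s * p := by nlinarith
  rw [hardyConst_eq, ENNReal.ofReal_mul (sliceConst_pos (by push_cast; linarith)).le,
    ofReal_integral_eq_lintegral_ofReal (integrableOn_profile hs0 hs1 hp1 hα hβ
      (div_mul_cancel₀ (1 + α + β - s * p) (by linarith)))]
  filter_upwards [ae_restrict_mem measurableSet_Ioo] with t ht using profile_nonneg ht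

/-- The factor `t^{-g} - 1` equals the base of the power and raises `p-1` to `p`. This is how `𝒟`
arises as a difference of two flux constants. -/
lemma fluxProfile_mul_of_pos {s p α β g t : ℝ} (hg : 0 < g) (ht : t ∈ Set.Ioo (0 : ℝ) 1) :
    fluxProfile s p α β g t * t ^ (-g) = fluxProfile s p α β g t + profile s p α β g t := by
  have h : 1 < t ^ (-g) := Real.one_lt_rpow_of_pos_of_lt_one_of_neg ht.1 ht.2 (by linarith)
  have e : |1 - t ^ (-g)| ^ p = |1 - t ^ (-g)| ^ (p - 1) * (t ^ (-g) - 1) := by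
    have h' : |1 - t ^ (-g)| = t ^ (-g) - 1 := by rw [abs_of_neg] <;> linarith
    conv_lhs => rw [show p = p - 1 + 1 by ring, Real.rpow_add_one (by rw [h']; linarith)]
    rw [h']
  unfold fluxProfile profile
  rw [e]; ring

lemma fluxProfile_eq_of_neg {s p α β g t : ℝ} (hg : g < 0) (ht : t ∈ Set.Ioo (0 : ℝ) 1) :
    fluxProfile s p α β g t = fluxProfile s p α β g t * t ^ (-g) + profile s p α β g t := by
  have h : t ^ (-g) < 1 := Real.rpow_lt_one ht.1.le ht.2 (by linarith)
  have e : |1 - t ^ (-g)| ^ p = |1 - t ^ (-g)| ^ (p - 1) * (1 - t ^ (-g)) := by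
    have h' : |1 - t ^ (-g)| = 1 - t ^ (-g) := by rw [abs_of_pos]; linarith
    conv_lhs => rw [show p = p - 1 + 1 by ring, Real.rpow_add_one (by rw [h']; linarith)]
    rw [h']
  unfold fluxProfile profile
  rw [e]; ring

/-- The cutoff matters: for `g ≠ 0` the integrand behaves like `(1-t)^{p-2-sp}` at `1`, which need
not be integrable. Away from `1` it is controlled by the profile plus `t^α + t^β`. -/
lemma lintegral_fluxProfile_lt_top {s p α β g θ : ℝ} (hs0 : 0 < s) (hs1 : s < 1) (hp1 : 1 < p)
    (hα : α ∈ Set.Ioo (-1) (s * p)) (hβ : β ∈ Set.Ioo (-1) (s * p))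
    (hg : g * p = 1 + α + β - s * p) (hθ1 : θ < 1) :
    ∫⁻ t in Set.Ioo 0 θ, ENNReal.ofReal (fluxProfile s p α β g t) < ⊤ := by
  have hsp : 0 < s * p := by nlinarith
  have hdom : IntegrableOn (fun t : ℝ => profile s p α β g t +
      1 / (1 - θ) ^ (1 + s * p) * (t ^ α + t ^ β)) (Set.Ioo 0 1) :=
    Integrable.add (integrableOn_profile hs0 hs1 hp1 hα hβ hg)
      (((integrableOn_rpow_Ioo hα.1).add (integrableOn_rpow_Ioo hβ.1)).const_mul _)
  have hdom' := hdom.mono_set (Set.Ioo_subset_Ioo_right hθ1.le)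
  have : IntegrableOn (fluxProfile s p α β g) (Set.Ioo 0 θ) := by
    refine Integrable.mono' hdom' (measurable_fluxProfile ..).aestronglyMeasurable ?_
    filter_upwards [ae_restrict_mem measurableSet_Ioo] with t ht
    have ht' : t ∈ Set.Ioo (0 : ℝ) 1 := ⟨ht.1, ht.2.trans hθ1⟩
    rw [Real.norm_of_nonneg (fluxProfile_nonneg ht')]
    have h0 := ht.1
    have h1 : 0 < 1 - t := by linarith [ht'.2]
    have h2 : 0 < 1 - θ := by linarith
    have h3 : 1 - θ ≤ 1 - t := by linarith [ht.2]
    have e : |1 - t ^ (-g)| ^ (p - 1) ≤ |1 - t ^ (-g)| ^ p + 1 := by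
      have hnn : 0 ≤ |1 - t ^ (-g)| ^ p := by positivity
      rcases le_or_gt |1 - t ^ (-g)| 1 with h | h
      · have := Real.rpow_le_one (abs_nonneg _) h (by linarith : 0 ≤ p - 1)
        linarith
      · have := Real.rpow_le_rpow_of_exponent_le h.le (by linarith : p - 1 ≤ p)
        linarith
    unfold fluxProfile profile
    calc _ ≤ (t ^ α + t ^ β) * (|1 - t ^ (-g)| ^ p + 1) / (1 - t) ^ (1 + s * p) := by gcongr
      _ = (t ^ α + t ^ β) * |1 - t ^ (-g)| ^ p / (1 - t) ^ (1 + s * p) +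
          1 / (1 - t) ^ (1 + s * p) * (t ^ α + t ^ β) := by ring
      _ ≤ _ := by gcongr
  exact this.lintegral_lt_top

/-- Scaling by `r = h t`. -/
lemma lintegral_flux_inner {s p α β g θ h : ℝ} (hh : 0 < h) (hθ1 : θ < 1) :
    ∫⁻ r in Set.Ioo 0 (θ * h), ENNReal.ofReal (|h ^ (-g) - r ^ (-g)| ^ (p - 1) *
        (h ^ α * r ^ β + h ^ β * r ^ α)) * ENNReal.ofReal (|h - r| ^ (-(1 + s * p))) =
      ENNReal.ofReal (h ^ (-(g * (p - 1)) + (α + β - s * p))) *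
        ∫⁻ t in Set.Ioo 0 θ, ENNReal.ofReal (fluxProfile s p α β g t) := by
  have himg : (fun t => h * t) '' Set.Ioo 0 θ = Set.Ioo 0 (θ * h) := by
    rw [Set.image_mul_left_Ioo hh, mul_zero, mul_comm]
  rw [← himg, lintegral_image_eq_lintegral_abs_deriv_mul measurableSet_Ioo (f' := fun _ => h)
    (fun x _ => by simpa using ((hasDerivAt_id x).const_mul h).hasDerivWithinAt)
    (fun x _ y _ hxy => mul_left_cancel₀ hh.ne' hxy),
    ← lintegral_const_mul' _ _ ENNReal.ofReal_ne_top]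
  refine setLIntegral_congr_fun measurableSet_Ioo fun t ht => ?_
  have t0 : 0 < t := ht.1
  have t1 : 0 < 1 - t := by linarith [ht.2]
  rw [← ENNReal.ofReal_mul (by positivity), ← ENNReal.ofReal_mul (by positivity),
    ← ENNReal.ofReal_mul (by positivity)]
  congr 1
  unfold fluxProfile
  rw [show h - h * t = h * (1 - t) by ring, abs_of_pos hh, abs_of_pos (mul_pos hh t1),
    Real.mul_rpow hh.le t0.le, Real.mul_rpow hh.le t0.le, Real.mul_rpow hh.le t0.le,
    Real.mul_rpow hh.le t1.le, show h ^ (-g) - h ^ (-g) * t ^ (-g) = h ^ (-g) * (1 - t ^ (-g)) by ring,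
    abs_mul, abs_of_pos (by positivity : 0 < h ^ (-g)),
    Real.mul_rpow (by positivity) (abs_nonneg _), ← Real.rpow_mul hh.le, Real.rpow_neg t1.le]
  have e : h ^ (-(g * (p - 1)) + (α + β - s * p)) =
      h * h ^ (-g * (p - 1)) * (h ^ α * h ^ β) * h ^ (-(1 + s * p)) := by
    rw [show -(g * (p - 1)) + (α + β - s * p) = 1 + -g * (p - 1) + (α + β) + -(1 + s * p) by ring,
      Real.rpow_add hh, Real.rpow_add hh, Real.rpow_add hh, Real.rpow_add hh, Real.rpow_one]
  rw [e]; ring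

/-- The inversion `r = h / t` maps the outer range to the same interval `(0, θ)`. By `gp = 1+α+β-sp`
the powers of `t` collapse to the single extra factor `t^{-g}`. -/
lemma lintegral_flux_outer {s p α β g θ h : ℝ} (hh : 0 < h) (hθ : 0 < θ) (hθ1 : θ < 1)
    (hg : g * p = 1 + α + β - s * p) :
    ∫⁻ r in Set.Ioi (h / θ), ENNReal.ofReal (|r ^ (-g) - h ^ (-g)| ^ (p - 1) *
        (r ^ α * h ^ β + r ^ β * h ^ α)) * ENNReal.ofReal (|h - r| ^ (-(1 + s * p))) =
      ENNReal.ofReal (h ^ (-(g * (p - 1)) + (α + β - s * p))) *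
        ∫⁻ t in Set.Ioo 0 θ, ENNReal.ofReal (fluxProfile s p α β g t * t ^ (-g)) := by
  have himg : (fun t => h / t) '' Set.Ioo 0 θ = Set.Ioi (h / θ) := by
    ext r
    simp only [Set.mem_image, Set.mem_Ioo, Set.mem_Ioi]
    constructor
    · rintro ⟨t, ⟨h0, h1⟩, rfl⟩
      gcongr
    · intro hr
      have r0 : 0 < r := lt_trans (by positivity) hr
      refine ⟨h / r, ⟨by positivity, ?_⟩, by field_simp⟩
      rw [div_lt_iff₀ hθ] at hr
      rw [div_lt_iff₀ r0]; linarith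
  rw [← himg, lintegral_image_eq_lintegral_abs_deriv_mul measurableSet_Ioo
    (f' := fun t => -(h / t ^ 2))
    (fun x hx => by
      have := ((hasDerivAt_inv hx.1.ne').const_mul h).hasDerivWithinAt (s := Set.Ioo 0 θ)
      simp only [div_eq_mul_inv]
      exact this.congr_deriv (by ring))
    (fun x hx y hy hxy => by
      have := hx.1; have := hy.1
      field_simp at hxy
      exact hxy.symm),
    ← lintegral_const_mul' _ _ ENNReal.ofReal_ne_top]
  refine setLIntegral_congr_fun measurableSet_Ioo fun t ht => ?_
  have t0 : 0 < t := ht.1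
  have t1 : 0 < 1 - t := by linarith [ht.2]
  rw [← ENNReal.ofReal_mul (by positivity), ← ENNReal.ofReal_mul (by positivity),
    ← ENNReal.ofReal_mul (by positivity)]
  congr 1
  unfold fluxProfile
  have i1 : |h - h / t| = h * (1 - t) / t := by
    rw [show h - h / t = -(h * (1 - t) / t) by field_simp; ring, abs_neg, abs_of_pos (by positivity)]
  have i2 : |(h / t) ^ (-g) - h ^ (-g)| = h ^ (-g) * t ^ g * |1 - t ^ (-g)| := by
    have : (h / t) ^ (-g) - h ^ (-g) = h ^ (-g) * t ^ g * (1 - t ^ (-g)) := by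
      rw [Real.div_rpow hh.le t0.le, Real.rpow_neg t0.le]
      have : t ^ g ≠ 0 := by positivity
      field_simp
    rw [this, abs_mul, abs_of_pos (by positivity)]
  have i3 : t ^ (g * (p - 1)) * t ^ (1 + s * p) = t ^ α * t ^ β * t ^ (-g) * t ^ 2 := by
    rw [← Real.rpow_natCast, ← Real.rpow_add t0, ← Real.rpow_add t0, ← Real.rpow_add t0,
      ← Real.rpow_add t0]
    congr 1; push_cast; linarith
  rw [i1, i2, Real.mul_rpow (by positivity) (abs_nonneg _),
    Real.mul_rpow (by positivity) (by positivity), ← Real.rpow_mul hh.le, ← Real.rpow_mul t0.le,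
    Real.div_rpow (mul_pos hh t1).le t0.le, Real.mul_rpow hh.le t1.le, Real.div_rpow hh.le t0.le,
    Real.div_rpow hh.le t0.le, abs_neg, abs_of_pos (by positivity), Real.rpow_neg t1.le,
    Real.rpow_neg t0.le (1 + s * p)]
  have e : h ^ (-(g * (p - 1)) + (α + β - s * p)) =
      h * h ^ (-g * (p - 1)) * (h ^ α * h ^ β) * h ^ (-(1 + s * p)) := by
    rw [show -(g * (p - 1)) + (α + β - s * p) = 1 + -g * (p - 1) + (α + β) + -(1 + s * p) by ring,
      Real.rpow_add hh, Real.rpow_add hh, Real.rpow_add hh, Real.rpow_add hh, Real.rpow_one]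
  have p1 : 0 < t ^ α := by positivity
  have p2 : 0 < t ^ β := by positivity
  have p3 : 0 < t ^ (1 + s * p) := by positivity
  have p4 : 0 < (1 - t) ^ (1 + s * p) := by positivity
  rw [e]
  calc _ = h * h ^ (-g * (p - 1)) * (h ^ α * h ^ β) * h ^ (-(1 + s * p)) *
        (t ^ (g * (p - 1)) * t ^ (1 + s * p)) * ((t ^ α + t ^ β) / (t ^ α * t ^ β)) *
        |1 - t ^ (-g)| ^ (p - 1) / (1 - t) ^ (1 + s * p) / t ^ 2 := by field_simp; ring
    _ = _ := by rw [i3]; field_simp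

/-! ### Folding onto the wedge and truncating -/

lemma measurableSet_halfSpace (n : ℕ) : MeasurableSet (halfSpace n) :=
  measurableSet_lt (by fun_prop) (by fun_prop)

lemma measurable_frenchPow (k : ℝ) : Measurable fun a => frenchPow a k := by
  have : Measurable Real.sign :=
    Measurable.ite measurableSet_Iio measurable_const
      (Measurable.ite measurableSet_Ioi measurable_const measurable_const)
  unfold frenchPow
  fun_prop

/-- The pairs of points of the half-space with `y_d < θ x_d`. -/
def wedge (n : ℕ) (θ : ℝ) :
    Set (EuclideanSpace ℝ (Fin (n + 1)) × EuclideanSpace ℝ (Fin (n + 1))) :=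
  {z | 0 < z.2 (Fin.last n) ∧ z.2 (Fin.last n) < θ * z.1 (Fin.last n)}

lemma measurableSet_wedge (n : ℕ) (θ : ℝ) : MeasurableSet (wedge n θ) :=
  MeasurableSet.inter
    (measurableSet_lt (f := fun _ => (0 : ℝ)) (g := fun z : EuclideanSpace ℝ (Fin (n + 1)) ×
      EuclideanSpace ℝ (Fin (n + 1)) => z.2 (Fin.last n)) (by fun_prop) (by fun_prop))
    (measurableSet_lt (f := fun z : EuclideanSpace ℝ (Fin (n + 1)) ×
      EuclideanSpace ℝ (Fin (n + 1)) => z.2 (Fin.last n)) (g := fun z => θ * z.1 (Fin.last n))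
      (by fun_prop) (by fun_prop))

lemma volume_last_eq (n : ℕ) (c : ℝ) :
    volume {y : EuclideanSpace ℝ (Fin (n + 1)) | y (Fin.last n) = c} = 0 := by
  have h := (PiLp.volume_preserving_ofLp (Fin (n + 1))).measure_preimage
    (s := {f | f (Fin.last n) = c})
    (measurableSet_eq_fun (measurable_pi_apply _) measurable_const).nullMeasurableSet
  rw [volume_pi, Measure.pi_hyperplane] at h
  exact h

/-- Pairs with equal last coordinates are negligible; the remaining ones form the wedge and its
mirror image. -/
lemma lintegral_halfSpace_symm {n : ℕ}
    {f : EuclideanSpace ℝ (Fin (n + 1)) × EuclideanSpace ℝ (Fin (n + 1)) → ENNReal}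
    (hf : Measurable f) :
    ∫⁻ x in halfSpace n, ∫⁻ y in halfSpace n, f (x, y) =
      ∫⁻ z in wedge n 1, (f z + f z.swap) ∂(volume.prod volume) := by
  rw [← lintegral_prod _ hf.aemeasurable, Measure.prod_restrict]
  have hae : halfSpace n ×ˢ halfSpace n =ᵐ[volume.prod volume]
      (wedge n 1 ∪ Prod.swap ⁻¹' wedge n 1 : Set _) := by
    have h0 : ∀ᵐ z : EuclideanSpace ℝ (Fin (n + 1)) × EuclideanSpace ℝ (Fin (n + 1))
        ∂(volume.prod volume), z.2 (Fin.last n) ≠ z.1 (Fin.last n) := by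
      rw [ae_iff, Measure.measure_prod_null]
      · refine Filter.Eventually.of_forall fun x => ?_
        simpa using volume_last_eq n (x (Fin.last n))
      · simp only [not_not]
        exact measurableSet_eq_fun (by fun_prop) (by fun_prop)
    filter_upwards [h0] with z hz
    refine propext ?_
    change (0 < z.1 (Fin.last n) ∧ 0 < z.2 (Fin.last n)) ↔
      ((0 < z.2 (Fin.last n) ∧ z.2 (Fin.last n) < 1 * z.1 (Fin.last n)) ∨
      (0 < z.1 (Fin.last n) ∧ z.1 (Fin.last n) < 1 * z.2 (Fin.last n)))
    rw [one_mul, one_mul]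
    constructor
    · rintro ⟨h1, h2⟩
      rcases lt_or_gt_of_ne hz with h | h
      · exact Or.inl ⟨h2, h⟩
      · exact Or.inr ⟨h1, h⟩
    · rintro (⟨h1, h2⟩ | ⟨h1, h2⟩)
      · exact ⟨h1.trans h2, h1⟩
      · exact ⟨h1, h1.trans h2⟩
  have hm := measurableSet_wedge n 1
  rw [setLIntegral_congr hae, lintegral_union (measurable_swap hm), lintegral_add_left hf]
  · congr 1
    exact ((Measure.measurePreserving_swap (μ := volume) (ν := volume)).setLIntegral_comp_preimage
      (f := fun z => f z.swap) hm (hf.comp measurable_swap))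
  · rw [Set.disjoint_left]
    rintro z ⟨_, h1⟩ ⟨_, h2⟩
    simp only [one_mul, Prod.fst_swap, Prod.snd_swap] at h1 h2
    exact lt_asymm h1 h2

/-- The truncation parameters exhausting `(0, 1)`. -/
noncomputable def cutoff (m : ℕ) : ℝ := 1 - 1 / ((m : ℝ) + 2)

lemma cutoff_mem (m : ℕ) : cutoff m ∈ Set.Ioo (0 : ℝ) 1 := by
  have : (0 : ℝ) ≤ m := m.cast_nonneg
  unfold cutoff
  constructor
  · rw [sub_pos, div_lt_one (by linarith)]; linarith
  · have : 0 < 1 / ((m : ℝ) + 2) := by positivity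
    linarith

lemma cutoff_mono : Monotone cutoff := fun a b h => by
  unfold cutoff
  gcongr

lemma exists_lt_cutoff {t : ℝ} (ht : t < 1) : ∃ m, t < cutoff m := by
  obtain ⟨m, hm⟩ := exists_nat_one_div_lt (sub_pos.2 ht)
  refine ⟨m, ?_⟩
  unfold cutoff
  have : 1 / ((m : ℝ) + 2) ≤ 1 / ((m : ℝ) + 1) := by gcongr; norm_num
  linarith

lemma wedge_mono {n : ℕ} {θ θ' : ℝ} (hθ : 0 < θ) (h : θ ≤ θ') : wedge n θ ⊆ wedge n θ' := by
  rintro z ⟨h1, h2⟩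
  refine ⟨h1, h2.trans_le ?_⟩
  have : 0 < z.1 (Fin.last n) := pos_of_mul_pos_right (h1.trans h2) hθ.le
  gcongr

lemma iUnion_wedge (n : ℕ) : ⋃ m, wedge n (cutoff m) = wedge n 1 := by
  apply Set.Subset.antisymm
  · exact Set.iUnion_subset fun m => wedge_mono (cutoff_mem m).1 (cutoff_mem m).2.le
  · rintro z ⟨h1, h2⟩
    rw [one_mul] at h2
    have h0 := h1.trans h2
    obtain ⟨m, hm⟩ := exists_lt_cutoff ((div_lt_one h0).2 h2)
    exact Set.mem_iUnion.2 ⟨m, h1, (div_lt_iff₀ h0).1 hm⟩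

lemma setLIntegral_wedge_one {n : ℕ}
    (f : EuclideanSpace ℝ (Fin (n + 1)) × EuclideanSpace ℝ (Fin (n + 1)) → ENNReal) :
    ∫⁻ z in wedge n 1, f z ∂(volume.prod volume) =
      ⨆ m, ∫⁻ z in wedge n (cutoff m), f z ∂(volume.prod volume) := by
  rw [← iUnion_wedge, setLIntegral_iUnion_of_directed]
  exact Monotone.directed_le fun a b h => wedge_mono (cutoff_mem a).1 (cutoff_mono h)

lemma setLIntegral_Ioo_one (f : ℝ → ENNReal) :
    ∫⁻ t in Set.Ioo 0 1, f t = ⨆ m, ∫⁻ t in Set.Ioo 0 (cutoff m), f t := by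
  have : Set.Ioo (0 : ℝ) 1 = ⋃ m, Set.Ioo 0 (cutoff m) := by
    apply Set.Subset.antisymm
    · rintro t ⟨h0, h1⟩
      obtain ⟨m, hm⟩ := exists_lt_cutoff h1
      exact Set.mem_iUnion.2 ⟨m, h0, hm⟩
    · exact Set.iUnion_subset fun m => Set.Ioo_subset_Ioo_right (cutoff_mem m).2.le
  rw [this, setLIntegral_iUnion_of_directed]
  exact Monotone.directed_le fun a b h => Set.Ioo_subset_Ioo_right (cutoff_mono h)

/-- The symmetrised kernel
`(x_d^α y_d^β + x_d^β y_d^α) |x - y|^{-d-sp}`. -/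
noncomputable def symmKernel (n : ℕ) (s p α β : ℝ)
    (z : EuclideanSpace ℝ (Fin (n + 1)) × EuclideanSpace ℝ (Fin (n + 1))) : ℝ :=
  (z.1 (Fin.last n) ^ α * z.2 (Fin.last n) ^ β + z.1 (Fin.last n) ^ β * z.2 (Fin.last n) ^ α) *
    ‖z.1 - z.2‖ ^ (-(((n + 1 : ℕ) : ℝ) + s * p))

lemma measurable_symmKernel (n : ℕ) (s p α β : ℝ) : Measurable (symmKernel n s p α β) := by
  unfold symmKernel; fun_prop

lemma wedge_pos {n : ℕ} {θ : ℝ} (hθ : 0 < θ)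
    {z : EuclideanSpace ℝ (Fin (n + 1)) × EuclideanSpace ℝ (Fin (n + 1))} (hz : z ∈ wedge n θ) :
    0 < z.1 (Fin.last n) ∧ 0 < z.2 (Fin.last n) :=
  ⟨pos_of_mul_pos_right (hz.1.trans hz.2) hθ.le, hz.1⟩

lemma symmKernel_nonneg {n : ℕ} {s p α β θ : ℝ} (hθ : 0 < θ)
    {z : EuclideanSpace ℝ (Fin (n + 1)) × EuclideanSpace ℝ (Fin (n + 1))} (hz : z ∈ wedge n θ) :
    0 ≤ symmKernel n s p α β z := by
  obtain ⟨h1, h2⟩ := wedge_pos hθ hz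
  unfold symmKernel; positivity

lemma measurable_groundState (n : ℕ) (s p α β : ℝ) : Measurable (groundState n s p α β) := by
  unfold groundState; fun_prop

lemma measurable_remainderWeight (n : ℕ) (s p α β : ℝ) :
    Measurable fun z : EuclideanSpace ℝ (Fin (n + 1)) × EuclideanSpace ℝ (Fin (n + 1)) =>
      remainderWeight n s p α β z.1 z.2 := by
  have := measurable_groundState n s p α β
  unfold remainderWeight; fun_prop

lemma double_lintegral_eq_wedge {n : ℕ} {s p α β : ℝ}
    {f : EuclideanSpace ℝ (Fin (n + 1)) → EuclideanSpace ℝ (Fin (n + 1)) → ℝ}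
    (hf : Measurable (Function.uncurry f)) (hsymm : ∀ x y, f x y = f y x)
    (hnn : ∀ x ∈ halfSpace n, ∀ y ∈ halfSpace n, 0 ≤ f x y) :
    ∫⁻ x in halfSpace n, ∫⁻ y in halfSpace n, ENNReal.ofReal
      (f x y * ‖x - y‖ ^ (-(((n + 1 : ℕ) : ℝ) + s * p)) * x (Fin.last n) ^ α *
        y (Fin.last n) ^ β) =
      ∫⁻ z in wedge n 1, ENNReal.ofReal (f z.1 z.2 * symmKernel n s p α β z)
        ∂(volume.prod volume) := by
  have hf' : Measurable fun z : EuclideanSpace ℝ (Fin (n + 1)) × EuclideanSpace ℝ (Fin (n + 1)) =>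
      f z.1 z.2 := hf
  rw [lintegral_halfSpace_symm (f := fun z => ENNReal.ofReal
      (f z.1 z.2 * ‖z.1 - z.2‖ ^ (-(((n + 1 : ℕ) : ℝ) + s * p)) * z.1 (Fin.last n) ^ α *
        z.2 (Fin.last n) ^ β)) (by fun_prop)]
  refine setLIntegral_congr_fun (measurableSet_wedge n 1) fun z hz => ?_
  obtain ⟨h1, h2⟩ := wedge_pos one_pos hz
  have h3 := hnn z.1 h1 z.2 h2
  have h4 := hnn z.2 h2 z.1 h1
  rw [← ENNReal.ofReal_add (by positivity) (by simp only [Prod.fst_swap, Prod.snd_swap]; positivity)]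
  congr 1
  simp only [Prod.fst_swap, Prod.snd_swap]
  rw [hsymm z.2 z.1, norm_sub_rev z.2 z.1]
  unfold symmKernel
  ring

/-! ### The two flux integrals over the wedge -/

/-- The second point is integrated out: slicing leaves an integral over heights in `(0, θ x_d)`, and
scaling extracts a power of `x_d`. -/
lemma lintegral_wedge_flux_fst {n : ℕ} {s p α β g θ : ℝ} (hsp : 0 < s * p) (hθ : 0 < θ)
    (hθ1 : θ < 1) {A : EuclideanSpace ℝ (Fin (n + 1)) → ENNReal} (hA : Measurable A) :
    ∫⁻ z in wedge n θ, A z.1 * ENNReal.ofReal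
        (|z.1 (Fin.last n) ^ (-g) - z.2 (Fin.last n) ^ (-g)| ^ (p - 1) * symmKernel n s p α β z)
        ∂(volume.prod volume) =
      ENNReal.ofReal (sliceConst n ((n + 1 : ℕ) + s * p)) *
        (∫⁻ t in Set.Ioo 0 θ, ENNReal.ofReal (fluxProfile s p α β g t)) *
        ∫⁻ x in halfSpace n, A x *
          ENNReal.ofReal (x (Fin.last n) ^ (-(g * (p - 1)) + (α + β - s * p))) := by
  have hK := measurable_symmKernel n s p α β
  rw [← lintegral_indicator (measurableSet_wedge n θ), lintegral_prod _
    (Measurable.aemeasurable (Measurable.indicator (by fun_prop) (measurableSet_wedge n θ))),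
    ← lintegral_indicator (measurableSet_halfSpace n), ← lintegral_const_mul]
  swap
  · exact Measurable.indicator (by fun_prop) (measurableSet_halfSpace n)
  refine lintegral_congr fun x => ?_
  by_cases hx : x ∈ halfSpace n
  swap
  · rw [Set.indicator_of_notMem hx, mul_zero]
    refine (lintegral_congr fun y => ?_).trans lintegral_zero
    exact Set.indicator_of_notMem (fun h => hx (wedge_pos (z := (x, y)) hθ h).1) _
  rw [Set.indicator_of_mem hx]
  have hx0 : 0 < x (Fin.last n) := hx
  set h := x (Fin.last n) with hh
  set φ : ℝ → ENNReal := (Set.Ioo 0 (θ * h)).indicator fun r => ENNReal.ofReal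
    (|h ^ (-g) - r ^ (-g)| ^ (p - 1) * (h ^ α * r ^ β + h ^ β * r ^ α)) with hφ
  have hφm : Measurable φ := Measurable.indicator (by fun_prop) measurableSet_Ioo
  have e : ∀ y, (wedge n θ).indicator (fun z : EuclideanSpace ℝ (Fin (n + 1)) ×
      EuclideanSpace ℝ (Fin (n + 1)) => A z.1 * ENNReal.ofReal
        (|z.1 (Fin.last n) ^ (-g) - z.2 (Fin.last n) ^ (-g)| ^ (p - 1) * symmKernel n s p α β z))
        (x, y) = A x * (φ (y (Fin.last n)) *
          ENNReal.ofReal (‖x - y‖ ^ (-(((n + 1 : ℕ) : ℝ) + s * p)))) := fun y => by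
    by_cases hy : (x, y) ∈ wedge n θ
    · have hy' : y (Fin.last n) ∈ Set.Ioo 0 (θ * h) := hy
      have hy0 := hy'.1
      rw [Set.indicator_of_mem hy, hφ, Set.indicator_of_mem hy',
        ← ENNReal.ofReal_mul (by positivity)]
      congr 2
      unfold symmKernel
      ring
    · have hy' : y (Fin.last n) ∉ Set.Ioo 0 (θ * h) := hy
      rw [Set.indicator_of_notMem hy, hφ, Set.indicator_of_notMem hy', zero_mul, mul_zero]
  simp_rw [e]
  rw [lintegral_const_mul _ (by fun_prop), lintegral_kernel_slice (by push_cast; linarith) φ hφm x]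
  have e2 : ∫⁻ r : ℝ, φ r * ENNReal.ofReal (|x (Fin.last n) - r| ^
      (-(((n + 1 : ℕ) : ℝ) + s * p - n))) = ∫⁻ r in Set.Ioo 0 (θ * h), ENNReal.ofReal
      (|h ^ (-g) - r ^ (-g)| ^ (p - 1) * (h ^ α * r ^ β + h ^ β * r ^ α)) *
        ENNReal.ofReal (|h - r| ^ (-(1 + s * p))) := by
    rw [← lintegral_indicator measurableSet_Ioo]
    refine lintegral_congr fun r => ?_
    have hexp : -(((n + 1 : ℕ) : ℝ) + s * p - n) = -(1 + s * p) := by push_cast; ring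
    rw [hφ, hexp, ← hh]
    simp only [Set.indicator]
    split_ifs <;> simp
  rw [e2, lintegral_flux_inner hx0 hθ1]
  ring

/-- Here the first point is integrated out, over heights above `x_d / θ`. The power of `x_d` agrees
with that of `lintegral_wedge_flux_fst`, so the two fluxes can be compared. -/
lemma lintegral_wedge_flux_snd {n : ℕ} {s p α β g θ : ℝ} (hsp : 0 < s * p) (hθ : 0 < θ)
    (hθ1 : θ < 1) (hg : g * p = 1 + α + β - s * p)
    {A : EuclideanSpace ℝ (Fin (n + 1)) → ENNReal} (hA : Measurable A) :
    ∫⁻ z in wedge n θ, A z.2 * ENNReal.ofReal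
        (|z.1 (Fin.last n) ^ (-g) - z.2 (Fin.last n) ^ (-g)| ^ (p - 1) * symmKernel n s p α β z)
        ∂(volume.prod volume) =
      ENNReal.ofReal (sliceConst n ((n + 1 : ℕ) + s * p)) *
        (∫⁻ t in Set.Ioo 0 θ, ENNReal.ofReal (fluxProfile s p α β g t * t ^ (-g))) *
        ∫⁻ x in halfSpace n, A x *
          ENNReal.ofReal (x (Fin.last n) ^ (-(g * (p - 1)) + (α + β - s * p))) := by
  have hK := measurable_symmKernel n s p α β
  rw [← lintegral_indicator (measurableSet_wedge n θ), lintegral_prod_symm _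
    (Measurable.aemeasurable (Measurable.indicator (by fun_prop) (measurableSet_wedge n θ))),
    ← lintegral_indicator (measurableSet_halfSpace n), ← lintegral_const_mul]
  swap
  · exact Measurable.indicator (by fun_prop) (measurableSet_halfSpace n)
  refine lintegral_congr fun x => ?_
  by_cases hx : x ∈ halfSpace n
  swap
  · rw [Set.indicator_of_notMem hx, mul_zero]
    refine (lintegral_congr fun y => ?_).trans lintegral_zero
    exact Set.indicator_of_notMem (fun h => hx (wedge_pos (z := (y, x)) hθ h).2) _
  rw [Set.indicator_of_mem hx]
  have hx0 : 0 < x (Fin.last n) := hx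
  set h := x (Fin.last n) with hh
  set φ : ℝ → ENNReal := (Set.Ioi (h / θ)).indicator fun r => ENNReal.ofReal
    (|r ^ (-g) - h ^ (-g)| ^ (p - 1) * (r ^ α * h ^ β + r ^ β * h ^ α)) with hφ
  have hφm : Measurable φ := Measurable.indicator (by fun_prop) measurableSet_Ioi
  have e : ∀ y, (wedge n θ).indicator (fun z : EuclideanSpace ℝ (Fin (n + 1)) ×
      EuclideanSpace ℝ (Fin (n + 1)) => A z.2 * ENNReal.ofReal
        (|z.1 (Fin.last n) ^ (-g) - z.2 (Fin.last n) ^ (-g)| ^ (p - 1) * symmKernel n s p α β z))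
        (y, x) = A x * (φ (y (Fin.last n)) *
          ENNReal.ofReal (‖x - y‖ ^ (-(((n + 1 : ℕ) : ℝ) + s * p)))) := fun y => by
    have hiff : (y, x) ∈ wedge n θ ↔ y (Fin.last n) ∈ Set.Ioi (h / θ) := by
      rw [Set.mem_Ioi, div_lt_iff₀ hθ, mul_comm]
      exact ⟨fun h => h.2, fun h => ⟨hx0, h⟩⟩
    by_cases hy : (y, x) ∈ wedge n θ
    · have hy' := hiff.1 hy
      have hy0 := (wedge_pos hθ hy).1
      simp only at hy0
      rw [Set.indicator_of_mem hy, hφ, Set.indicator_of_mem hy',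
        ← ENNReal.ofReal_mul (by positivity)]
      congr 2
      unfold symmKernel
      rw [norm_sub_rev x y]
      ring
    · have hy' := fun h => hy (hiff.2 h)
      rw [Set.indicator_of_notMem hy, hφ, Set.indicator_of_notMem hy', zero_mul, mul_zero]
  simp_rw [e]
  rw [lintegral_const_mul _ (by fun_prop), lintegral_kernel_slice (by push_cast; linarith) φ hφm x]
  have e2 : ∫⁻ r : ℝ, φ r * ENNReal.ofReal (|x (Fin.last n) - r| ^
      (-(((n + 1 : ℕ) : ℝ) + s * p - n))) = ∫⁻ r in Set.Ioi (h / θ), ENNReal.ofReal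
      (|r ^ (-g) - h ^ (-g)| ^ (p - 1) * (r ^ α * h ^ β + r ^ β * h ^ α)) *
        ENNReal.ofReal (|h - r| ^ (-(1 + s * p))) := by
    rw [← lintegral_indicator measurableSet_Ioi]
    refine lintegral_congr fun r => ?_
    have hexp : -(((n + 1 : ℕ) : ℝ) + s * p - n) = -(1 + s * p) := by push_cast; ring
    rw [hφ, hexp, ← hh]
    simp only [Set.indicator]
    split_ifs <;> simp
  rw [e2, lintegral_flux_outer hx0 hθ hθ1 hg]
  ring

/-! ### From the pointwise inequality to the Hardy inequality -/

/-- Pairs of values for which the normalised pointwise inequality holds with constant `C`. -/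
def GapOn (p C : ℝ) (S : Set ℝ) : Prop :=
  ∀ A ∈ S, ∀ B ∈ S, B ≠ 0 → ∀ t ∈ Set.Icc (0 : ℝ) 1,
    C * t * (frenchPow (A / B) (p / 2) - 1) ^ 2 ≤
      |A / B - t| ^ p - (1 - t) ^ (p - 1) * (|A / B| ^ p - t)

lemma weighted_gap_abs {p C : ℝ} (hp1 : 1 < p) (hp2 : p < 2) (hC : C ≤ p - 1) {S : Set ℝ}
    (hS : GapOn p C S) {v₁ v₂ w₁ w₂ : ℝ} (h1 : v₁ ∈ S) (h2 : v₂ ∈ S) (hw : 0 < w₁)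
    (hw' : w₁ ≤ w₂) :
    |w₁ - w₂| ^ (p - 1) * (w₂ * |v₂| ^ p) +
        C * ((frenchPow v₁ (p / 2) - frenchPow v₂ (p / 2)) ^ 2 *
          (min w₁ w₂ * max w₁ w₂ ^ (p - 1))) ≤
      |w₁ * v₁ - w₂ * v₂| ^ p + |w₁ - w₂| ^ (p - 1) * (w₁ * |v₁| ^ p) := by
  have := weighted_gap hp1 hp2 hC hS h2 h1 hw hw'
  rw [min_eq_left hw', max_eq_right hw', abs_sub_comm w₁, abs_of_nonneg (sub_nonneg.2 hw'),
    abs_sub_comm (w₁ * v₁)]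
  calc _ = _ := by ring
    _ ≤ _ := this

lemma ofReal_gap {C a b e r f k : ℝ} (hC : 0 ≤ C) (ha : 0 ≤ a) (hb : 0 ≤ b) (he : 0 ≤ e)
    (hr : 0 ≤ r) (hf : 0 ≤ f) (hk : 0 ≤ k) (h : f * a + C * r ≤ e + f * b) :
    ENNReal.ofReal a * ENNReal.ofReal (f * k) + ENNReal.ofReal C * ENNReal.ofReal (r * k) ≤
      ENNReal.ofReal (e * k) + ENNReal.ofReal b * ENNReal.ofReal (f * k) := by
  rw [← ENNReal.ofReal_mul ha, ← ENNReal.ofReal_mul hC, ← ENNReal.ofReal_mul hb,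
    ← ENNReal.ofReal_add (by positivity) (by positivity),
    ← ENNReal.ofReal_add (by positivity) (by positivity)]
  apply ENNReal.ofReal_le_ofReal
  nlinarith

lemma remainder_eq_wedge {n : ℕ} {s p α β : ℝ} {v : EuclideanSpace ℝ (Fin (n + 1)) → ℝ}
    (hv : Measurable v) :
    remainder n s p α β v = ∫⁻ z in wedge n 1, ENNReal.ofReal
      ((frenchPow (v z.1) (p / 2) - frenchPow (v z.2) (p / 2)) ^ 2 *
        remainderWeight n s p α β z.1 z.2 * symmKernel n s p α β z) ∂(volume.prod volume) := by
  have hf := measurable_frenchPow (p / 2)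
  have hw := measurable_remainderWeight n s p α β
  rw [← double_lintegral_eq_wedge (f := fun x y =>
    (frenchPow (v x) (p / 2) - frenchPow (v y) (p / 2)) ^ 2 * remainderWeight n s p α β x y)]
  · unfold remainder
    refine lintegral_congr fun x => lintegral_congr fun y => ?_
    rw [Real.rpow_neg (norm_nonneg _)]
    congr 1; ring
  · unfold Function.uncurry
    refine Measurable.mul (Measurable.pow_const (Measurable.sub ?_ ?_) 2) hw
    · exact hf.comp (hv.comp measurable_fst)
    · exact hf.comp (hv.comp measurable_snd)
  · intro x y
    unfold remainderWeight
    rw [min_comm, max_comm]; ring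
  · intro x hx y hy
    have hx' : 0 < x (Fin.last n) := hx
    have hy' : 0 < y (Fin.last n) := hy
    unfold remainderWeight groundState
    positivity

/-- An inequality suffices, which admits `U = ‖u‖` through the reverse triangle inequality. -/
lemma wedge_le_energy {F : Type*} [NormedAddCommGroup F] {n : ℕ} {s p α β : ℝ} (hp : 0 ≤ p)
    {u : EuclideanSpace ℝ (Fin (n + 1)) → F} {U : EuclideanSpace ℝ (Fin (n + 1)) → ℝ}
    (hU : Measurable U)
    (hUu : ∀ x ∈ halfSpace n, ∀ y ∈ halfSpace n, |U x - U y| ≤ ‖u x - u y‖) :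
    ∫⁻ z in wedge n 1, ENNReal.ofReal (|U z.1 - U z.2| ^ p * symmKernel n s p α β z)
      ∂(volume.prod volume) ≤ energy n s p α β u := by
  rw [← double_lintegral_eq_wedge (f := fun x y => |U x - U y| ^ p)]
  · unfold energy
    refine setLIntegral_mono' (measurableSet_halfSpace n) fun x hx =>
      setLIntegral_mono' (measurableSet_halfSpace n) fun y hy => ENNReal.ofReal_le_ofReal ?_
    have hx' : 0 < x (Fin.last n) := hx
    have hy' : 0 < y (Fin.last n) := hy
    rw [Real.rpow_neg (norm_nonneg _), ← div_eq_mul_inv]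
    have := hUu x hx y hy
    gcongr
  · unfold Function.uncurry; fun_prop
  · intro x y; rw [abs_sub_comm]
  · intro x _ y _; positivity

/-- The flux weight `w |v|^p`, multiplied by the power of `x_d` from scaling, is the Hardy density.
-/
lemma hardy_density {s p α β g h a : ℝ} (hh : 0 < h) :
    ENNReal.ofReal (h ^ (-g) * |a * h ^ g| ^ p) *
        ENNReal.ofReal (h ^ (-(g * (p - 1)) + (α + β - s * p))) =
      ENNReal.ofReal (|a| ^ p / h ^ (s * p - α - β)) := by
  rw [← ENNReal.ofReal_mul (by positivity), abs_mul, abs_of_pos (by positivity : 0 < h ^ g),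
    Real.mul_rpow (abs_nonneg _) (by positivity), ← Real.rpow_mul hh.le, div_eq_mul_inv,
    ← Real.rpow_neg hh.le]
  congr 1
  have : h ^ (-(s * p - α - β)) =
      h ^ (-g) * h ^ (g * p) * h ^ (-(g * (p - 1)) + (α + β - s * p)) := by
    rw [← Real.rpow_add hh, ← Real.rpow_add hh]; congr 1; ring
  rw [this]; ring

/-- The truncated inequality, with the finite flux term on both sides. -/
lemma truncated_hardy {n : ℕ} {s p α β g C θ : ℝ} (hs0 : 0 < s) (hs1 : s < 1) (hp1 : 1 < p)
    (hp2 : p < 2) (hα : α ∈ Set.Ioo (-1) (s * p)) (hβ : β ∈ Set.Ioo (-1) (s * p))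
    (hg : g * p = 1 + α + β - s * p) (hg0 : g ≠ 0) (hC0 : 0 ≤ C) (hC : C ≤ p - 1) {S : Set ℝ}
    (hS : GapOn p C S) {U : EuclideanSpace ℝ (Fin (n + 1)) → ℝ} (hU : Measurable U)
    (hUS : ∀ x ∈ halfSpace n, U x * x (Fin.last n) ^ g ∈ S)
    {H : ENNReal} (hH : H = ∫⁻ x in halfSpace n,
      ENNReal.ofReal (|U x| ^ p / x (Fin.last n) ^ (s * p - α - β))) (hfin : H < ⊤)
    (hθ : 0 < θ) (hθ1 : θ < 1) :
    ENNReal.ofReal (sliceConst n ((n + 1 : ℕ) + s * p)) *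
        (∫⁻ t in Set.Ioo 0 θ, ENNReal.ofReal (profile s p α β g t)) * H +
      ENNReal.ofReal C * ∫⁻ z in wedge n θ, ENNReal.ofReal
        ((frenchPow (U z.1 * z.1 (Fin.last n) ^ g) (p / 2) -
          frenchPow (U z.2 * z.2 (Fin.last n) ^ g) (p / 2)) ^ 2 *
          (min (z.1 (Fin.last n) ^ (-g)) (z.2 (Fin.last n) ^ (-g)) *
            max (z.1 (Fin.last n) ^ (-g)) (z.2 (Fin.last n) ^ (-g)) ^ (p - 1)) *
          symmKernel n s p α β z) ∂(volume.prod volume) ≤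
      ∫⁻ z in wedge n θ, ENNReal.ofReal (|U z.1 - U z.2| ^ p * symmKernel n s p α β z)
        ∂(volume.prod volume) := by
  have hsp : 0 < s * p := by nlinarith
  set c := ENNReal.ofReal (sliceConst n ((n + 1 : ℕ) + s * p)) with hc
  set D := ∫⁻ t in Set.Ioo 0 θ, ENNReal.ofReal (profile s p α β g t)
  set D₁ := ∫⁻ t in Set.Ioo 0 θ, ENNReal.ofReal (fluxProfile s p α β g t) with hD₁
  set D₂ := ∫⁻ t in Set.Ioo 0 θ, ENNReal.ofReal (fluxProfile s p α β g t * t ^ (-g)) with hD₂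
  set R := ∫⁻ z in wedge n θ, ENNReal.ofReal
        ((frenchPow (U z.1 * z.1 (Fin.last n) ^ g) (p / 2) -
          frenchPow (U z.2 * z.2 (Fin.last n) ^ g) (p / 2)) ^ 2 *
          (min (z.1 (Fin.last n) ^ (-g)) (z.2 (Fin.last n) ^ (-g)) *
            max (z.1 (Fin.last n) ^ (-g)) (z.2 (Fin.last n) ^ (-g)) ^ (p - 1)) *
          symmKernel n s p α β z) ∂(volume.prod volume) with hR
  set E := ∫⁻ z in wedge n θ, ENNReal.ofReal (|U z.1 - U z.2| ^ p * symmKernel n s p α β z)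
        ∂(volume.prod volume) with hE
  have hK := measurable_symmKernel n s p α β
  set A : EuclideanSpace ℝ (Fin (n + 1)) → ENNReal := fun x =>
    ENNReal.ofReal (x (Fin.last n) ^ (-g) * |U x * x (Fin.last n) ^ g| ^ p) with hA
  have hAm : Measurable A := by fun_prop
  have hHA : ∫⁻ x in halfSpace n, A x *
      ENNReal.ofReal (x (Fin.last n) ^ (-(g * (p - 1)) + (α + β - s * p))) = H := by
    rw [hH]
    exact setLIntegral_congr_fun (measurableSet_halfSpace n) fun x hx => hardy_density hx
  have hI₁ := lintegral_wedge_flux_fst (n := n) (α := α) (β := β) (g := g) hsp hθ hθ1 hAm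
  have hI₂ := lintegral_wedge_flux_snd (n := n) hsp hθ hθ1 hg hAm
  rw [hHA, ← hc, ← hD₁] at hI₁
  rw [hHA, ← hc, ← hD₂] at hI₂
  have hfl := measurable_fluxProfile s p α β g
  have hpr := measurable_profile s p α β g
  have hf := measurable_frenchPow (p / 2)
  have hRm : Measurable fun z : EuclideanSpace ℝ (Fin (n + 1)) × EuclideanSpace ℝ (Fin (n + 1)) =>
      ENNReal.ofReal ((frenchPow (U z.1 * z.1 (Fin.last n) ^ g) (p / 2) -
          frenchPow (U z.2 * z.2 (Fin.last n) ^ g) (p / 2)) ^ 2 *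
          (min (z.1 (Fin.last n) ^ (-g)) (z.2 (Fin.last n) ^ (-g)) *
            max (z.1 (Fin.last n) ^ (-g)) (z.2 (Fin.last n) ^ (-g)) ^ (p - 1)) *
          symmKernel n s p α β z) := by
    have hf1 : Measurable fun z : EuclideanSpace ℝ (Fin (n + 1)) ×
        EuclideanSpace ℝ (Fin (n + 1)) => frenchPow (U z.1 * z.1 (Fin.last n) ^ g) (p / 2) :=
      hf.comp (by fun_prop)
    have hf2 : Measurable fun z : EuclideanSpace ℝ (Fin (n + 1)) ×
        EuclideanSpace ℝ (Fin (n + 1)) => frenchPow (U z.2 * z.2 (Fin.last n) ^ g) (p / 2) :=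
      hf.comp (by fun_prop)
    fun_prop
  have hIoo : ∀ t ∈ Set.Ioo 0 θ, t ∈ Set.Ioo (0 : ℝ) 1 := fun t ht => ⟨ht.1, ht.2.trans hθ1⟩
  have hU' : ∀ x ∈ halfSpace n, U x = x (Fin.last n) ^ (-g) * (U x * x (Fin.last n) ^ g) :=
    fun x hx => by
      have hx' : 0 < x (Fin.last n) := hx
      have : x (Fin.last n) ^ g ≠ 0 := by positivity
      rw [Real.rpow_neg hx'.le]; field_simp
  have hD₁fin : D₁ < ⊤ := lintegral_fluxProfile_lt_top hs0 hs1 hp1 hα hβ hg hθ1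
  -- On the wedge the first point is the higher one. It carries the larger `w` when `g < 0` and the
  -- smaller one when `g > 0`, so the roles of the two fluxes are exchanged.
  rcases lt_or_gt_of_ne hg0 with hneg | hpos
  · have hDD : D₁ = D₂ + D := by
      rw [hD₂, ← lintegral_add_left (by fun_prop)]
      refine setLIntegral_congr_fun measurableSet_Ioo fun t ht => ?_
      rw [← ENNReal.ofReal_add (mul_nonneg (fluxProfile_nonneg (hIoo t ht))
        (Real.rpow_nonneg ht.1.le _)) (profile_nonneg (hIoo t ht)),
        ← fluxProfile_eq_of_neg hneg (hIoo t ht)]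
    have hD₂fin : D₂ < ⊤ := lt_of_le_of_lt (by rw [hDD]; exact le_self_add) hD₁fin
    have key : c * D₁ * H + ENNReal.ofReal C * R ≤ E + c * D₂ * H := by
      rw [← hI₁, ← hI₂, hR, hE, ← lintegral_const_mul _ hRm, ← lintegral_add_left (by fun_prop),
        ← lintegral_add_left (by fun_prop)]
      refine setLIntegral_mono' (measurableSet_wedge n θ) fun z hz => ?_
      obtain ⟨h1, h2⟩ := wedge_pos hθ hz
      have hlt : z.2 (Fin.last n) ≤ z.1 (Fin.last n) := by nlinarith [hz.2]
      have hgap := weighted_gap_abs hp1 hp2 hC hS (hUS z.2 h2) (hUS z.1 h1)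
        (Real.rpow_pos_of_pos h2 (-g)) (Real.rpow_le_rpow h2.le hlt (by linarith))
      rw [← hU' _ h1, ← hU' _ h2] at hgap
      refine ofReal_gap hC0 (by positivity) (by positivity) (by positivity) (by positivity)
        (by positivity) (symmKernel_nonneg hθ hz) ?_
      rw [abs_sub_comm (U z.1), abs_sub_comm (z.1 (Fin.last n) ^ (-g)), min_comm, max_comm]
      calc _ = _ := by ring
        _ ≤ _ := hgap
    -- Finiteness of the smaller flux permits its cancellation in `[0, ∞]`.
    have hne : c * D₂ * H ≠ ⊤ :=
      ENNReal.mul_ne_top (ENNReal.mul_ne_top ENNReal.ofReal_ne_top hD₂fin.ne) hfin.ne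
    rw [hDD] at key
    refine (ENNReal.add_le_add_iff_left hne).1 ?_
    calc _ = c * (D₂ + D) * H + ENNReal.ofReal C * R := by ring
      _ ≤ _ := key
      _ = _ := by ring
  · have hDD : D₂ = D₁ + D := by
      rw [hD₁, ← lintegral_add_left (by fun_prop)]
      refine setLIntegral_congr_fun measurableSet_Ioo fun t ht => ?_
      rw [← ENNReal.ofReal_add (fluxProfile_nonneg (hIoo t ht)) (profile_nonneg (hIoo t ht)),
        ← fluxProfile_mul_of_pos hpos (hIoo t ht)]
    have key : c * D₂ * H + ENNReal.ofReal C * R ≤ E + c * D₁ * H := by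
      rw [← hI₁, ← hI₂, hR, hE, ← lintegral_const_mul _ hRm, ← lintegral_add_left (by fun_prop),
        ← lintegral_add_left (by fun_prop)]
      refine setLIntegral_mono' (measurableSet_wedge n θ) fun z hz => ?_
      obtain ⟨h1, h2⟩ := wedge_pos hθ hz
      have hlt : z.2 (Fin.last n) ≤ z.1 (Fin.last n) := by nlinarith [hz.2]
      have hgap := weighted_gap_abs hp1 hp2 hC hS (hUS z.1 h1) (hUS z.2 h2)
        (Real.rpow_pos_of_pos h1 (-g)) (Real.rpow_le_rpow_of_nonpos h2 hlt (by linarith))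
      rw [← hU' _ h1, ← hU' _ h2] at hgap
      exact ofReal_gap hC0 (by positivity) (by positivity) (by positivity) (by positivity)
        (by positivity) (symmKernel_nonneg hθ hz) hgap
    have hne : c * D₁ * H ≠ ⊤ :=
      ENNReal.mul_ne_top (ENNReal.mul_ne_top ENNReal.ofReal_ne_top hD₁fin.ne) hfin.ne
    rw [hDD] at key
    refine (ENNReal.add_le_add_iff_left hne).1 ?_
    calc _ = c * (D₁ + D) * H + ENNReal.ofReal C * R := by ring
      _ ≤ _ := key
      _ = _ := by ring

theorem hardyWithRemainder_of_gapOn {F : Type*} [NormedAddCommGroup F] {n : ℕ} {s p α β C : ℝ}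
    (hs0 : 0 < s) (hs1 : s < 1) (hp1 : 1 < p)
    (hp2 : p < 2) (hα : α ∈ Set.Ioo (-1) (s * p)) (hβ : β ∈ Set.Ioo (-1) (s * p))
    (hne : 1 + α + β ≠ s * p) (hC0 : 0 ≤ C) (hC : C ≤ p - 1) {S : Set ℝ}
    (hS : GapOn p C S) {u : EuclideanSpace ℝ (Fin (n + 1)) → F}
    {U v : EuclideanSpace ℝ (Fin (n + 1)) → ℝ} (hU : Measurable U)
    (hUnorm : ∀ x ∈ halfSpace n, |U x| = ‖u x‖)
    (hUsub : ∀ x ∈ halfSpace n, ∀ y ∈ halfSpace n, |U x - U y| ≤ ‖u x - u y‖)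
    (hUS : ∀ x ∈ halfSpace n, U x * x (Fin.last n) ^ ((1 + α + β - s * p) / p) ∈ S)
    (hv : ∀ x ∈ halfSpace n, v x = U x * x (Fin.last n) ^ ((1 + α + β - s * p) / p))
    (hfin : hardyTerm n s p α β u < ⊤) :
    HardyWithRemainder n s p α β C u v := by
  refine ⟨hfin, ?_⟩
  have hp0 : p ≠ 0 := by linarith
  have hg : (1 + α + β - s * p) / p * p = 1 + α + β - s * p := div_mul_cancel₀ _ hp0
  have hg0 : (1 + α + β - s * p) / p ≠ 0 := div_ne_zero (sub_ne_zero.2 hne) hp0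
  have hrem : remainder n s p α β v = remainder n s p α β
      (fun x => U x * x (Fin.last n) ^ ((1 + α + β - s * p) / p)) := by
    unfold remainder
    refine setLIntegral_congr_fun (measurableSet_halfSpace n) fun x hx =>
      setLIntegral_congr_fun (measurableSet_halfSpace n) fun y hy => ?_
    simp only [hv x hx, hv y hy]
  have hH : hardyTerm n s p α β u = ∫⁻ x in halfSpace n,
      ENNReal.ofReal (|U x| ^ p / x (Fin.last n) ^ (s * p - α - β)) :=
    setLIntegral_congr_fun (measurableSet_halfSpace n) fun x hx => by simp only [hUnorm x hx]
  -- The constant and the remainder are suprema over the same cutoffs; by monotonicity their sum is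
  -- a single supremum, bounded term by term.
  rw [hrem, remainder_eq_wedge (by fun_prop), setLIntegral_wedge_one,
    ofReal_hardyConst hs0 hs1 hp1 hα hβ, setLIntegral_Ioo_one, ENNReal.mul_iSup, ENNReal.iSup_mul,
    ENNReal.mul_iSup, ENNReal.iSup_add_iSup_of_monotone]
  · refine iSup_le fun m => ?_
    refine (truncated_hardy hs0 hs1 hp1 hp2 hα hβ hg hg0 hC0 hC hS hU hUS hH hfin
      (cutoff_mem m).1 (cutoff_mem m).2).trans ?_
    refine le_trans ?_ (wedge_le_energy (by linarith) hU hUsub)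
    exact lintegral_mono_set (wedge_mono (cutoff_mem m).1 (cutoff_mem m).2.le)
  · intro a b hab
    have : Set.Ioo 0 (cutoff a) ⊆ Set.Ioo 0 (cutoff b) := Set.Ioo_subset_Ioo_right (cutoff_mono hab)
    dsimp only
    gcongr
  · intro a b hab
    have := wedge_mono (n := n) (cutoff_mem a).1 (cutoff_mono hab)
    dsimp only
    gcongr

/-! ### Finiteness of the Hardy term -/

lemma norm_slicePoint_sq {n : ℕ} (r : ℝ) (z : EuclideanSpace ℝ (Fin n)) :
    ‖slicePoint r z‖ ^ 2 = ‖z‖ ^ 2 + r ^ 2 := by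
  have h0 : slicePoint 0 (0 : EuclideanSpace ℝ (Fin n)) = 0 := by
    ext i
    refine Fin.succAboveCases (Fin.last n) ?_ (fun j => ?_) i <;> simp [slicePoint]
  simpa [h0] using norm_slicePoint_sub_sq r 0 z 0

/-- The half-ball lies in the product of `(0, R]` and a ball, where only the integrability of
`r^{-δ}` at `0` matters. -/
lemma lintegral_box_rpow_lt_top {n : ℕ} {δ R : ℝ} (hδ : δ < 1) (hR : 0 ≤ R) :
    ∫⁻ x : EuclideanSpace ℝ (Fin (n + 1)), (halfSpace n ∩ Metric.closedBall 0 R).indicator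
      (fun x => ENNReal.ofReal (x (Fin.last n) ^ (-δ))) x < ⊤ := by
  rw [lintegral_slice _ (Measurable.indicator (by fun_prop)
    ((measurableSet_halfSpace n).inter measurableSet_closedBall))]
  have hle : ∀ (r : ℝ) (z : EuclideanSpace ℝ (Fin n)),
      (halfSpace n ∩ Metric.closedBall 0 R).indicator
        (fun x => ENNReal.ofReal (x (Fin.last n) ^ (-δ))) (slicePoint r z) ≤
      (Set.Ioc 0 R).indicator (fun r : ℝ => ENNReal.ofReal (r ^ (-δ))) r *
        (Metric.closedBall (0 : EuclideanSpace ℝ (Fin n)) R).indicator 1 z := fun r z => by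
    by_cases h : slicePoint r z ∈ halfSpace n ∩ Metric.closedBall 0 R
    · have hr : 0 < r := by simpa [halfSpace] using h.1
      have hn : ‖slicePoint r z‖ ≤ R := by simpa using h.2
      have hsq := norm_slicePoint_sq r z
      have hrR : r ≤ R := abs_le_of_sq_le_sq' (by nlinarith [norm_nonneg (slicePoint r z)]) hR |>.2
      have hzR : ‖z‖ ≤ R :=
        abs_le_of_sq_le_sq' (by nlinarith [norm_nonneg (slicePoint r z)]) hR |>.2
      rw [Set.indicator_of_mem h, Set.indicator_of_mem (Set.mem_Ioc.2 ⟨hr, hrR⟩),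
        Set.indicator_of_mem (by simpa using hzR)]
      simp
    · rw [Set.indicator_of_notMem h]; exact zero_le
  refine lt_of_le_of_lt (lintegral_mono fun r => lintegral_mono fun z => hle r z) ?_
  have e : ∀ r : ℝ, ∫⁻ z : EuclideanSpace ℝ (Fin n),
      (Set.Ioc 0 R).indicator (fun r : ℝ => ENNReal.ofReal (r ^ (-δ))) r *
        (Metric.closedBall (0 : EuclideanSpace ℝ (Fin n)) R).indicator 1 z =
      (Set.Ioc 0 R).indicator (fun r : ℝ => ENNReal.ofReal (r ^ (-δ))) r *
        volume (Metric.closedBall (0 : EuclideanSpace ℝ (Fin n)) R) := fun r => by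
    rw [lintegral_const_mul _ (measurable_one.indicator measurableSet_closedBall),
      lintegral_indicator_one measurableSet_closedBall]
  simp_rw [e]
  rw [lintegral_mul_const _ (Measurable.indicator (by fun_prop) measurableSet_Ioc),
    lintegral_indicator measurableSet_Ioc]
  refine ENNReal.mul_lt_top ?_ measure_closedBall_lt_top
  exact ((intervalIntegrable_iff_integrableOn_Ioc_of_le hR).1
    (intervalIntegral.intervalIntegrable_rpow' (by linarith))).lintegral_lt_top

lemma hardyTerm_lt_top_of_open {F : Type*} [NormedAddCommGroup F] [NormedSpace ℝ F] {n : ℕ}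
    {s p α β : ℝ} (hp : 0 < p) {u : EuclideanSpace ℝ (Fin (n + 1)) → F}
    (hu : IsC1c (halfSpace n) u) : hardyTerm n s p α β u < ⊤ := by
  obtain ⟨hC1, K, hKS, hK, h0⟩ := hu
  have hcont : ContinuousOn (fun x : EuclideanSpace ℝ (Fin (n + 1)) =>
      ‖u x‖ ^ p / x (Fin.last n) ^ (s * p - α - β)) K := by
    refine ContinuousOn.div ?_ ?_ ?_
    · exact (hC1.continuousOn.mono hKS).norm.rpow_const fun x _ => Or.inr hp.le
    · exact ContinuousOn.rpow_const (by fun_prop) fun x hx => Or.inl (ne_of_gt (hKS hx))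
    · exact fun x hx => (Real.rpow_pos_of_pos (hKS hx) _).ne'
  obtain ⟨M, hM⟩ := hK.exists_bound_of_continuousOn hcont
  have hle : hardyTerm n s p α β u ≤
      ∫⁻ x : EuclideanSpace ℝ (Fin (n + 1)), K.indicator (fun _ => ENNReal.ofReal M) x := by
    refine (setLIntegral_mono' (measurableSet_halfSpace n) fun x hx => ?_).trans
      (setLIntegral_le_lintegral _ _)
    by_cases hxK : x ∈ K
    · rw [Set.indicator_of_mem hxK]
      exact ENNReal.ofReal_le_ofReal ((le_abs_self _).trans (hM x hxK))
    · rw [h0 x hx hxK, norm_zero, Real.zero_rpow hp.ne', zero_div, ENNReal.ofReal_zero]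
      exact zero_le
  refine hle.trans_lt ?_
  rw [lintegral_indicator_const hK.measurableSet]
  exact ENNReal.mul_lt_top ENNReal.ofReal_lt_top hK.measure_lt_top

lemma hardyTerm_lt_top_of_closed {F : Type*} [NormedAddCommGroup F] [NormedSpace ℝ F] {n : ℕ}
    {s p α β : ℝ} (hp : 0 < p) (hδ : s * p < 1 + α + β)
    {u : EuclideanSpace ℝ (Fin (n + 1)) → F}
    (hu : IsC1c (closedHalfSpace n) u) : hardyTerm n s p α β u < ⊤ := by
  obtain ⟨hC1, K, hKS, hK, h0⟩ := hu
  obtain ⟨M, hM⟩ := hK.exists_bound_of_continuousOn (hC1.continuousOn.mono hKS)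
  obtain ⟨R, hR0, hR⟩ := hK.isBounded.subset_closedBall_lt 0 0
  have hle : hardyTerm n s p α β u ≤ ∫⁻ x : EuclideanSpace ℝ (Fin (n + 1)),
      ENNReal.ofReal (M ^ p) * (halfSpace n ∩ Metric.closedBall 0 R).indicator
        (fun x => ENNReal.ofReal (x (Fin.last n) ^ (-(s * p - α - β)))) x := by
    refine (setLIntegral_mono' (measurableSet_halfSpace n) fun x hx => ?_).trans
      (setLIntegral_le_lintegral _ _)
    have hx0 : 0 < x (Fin.last n) := hx
    by_cases hxK : x ∈ K
    · rw [Set.indicator_of_mem (Set.mem_inter hx (hR hxK)), Real.rpow_neg hx0.le, div_eq_mul_inv,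
        ENNReal.ofReal_mul (by positivity)]
      have := hM x hxK
      gcongr
    · rw [h0 x (le_of_lt hx0) hxK, norm_zero, Real.zero_rpow hp.ne', zero_div, ENNReal.ofReal_zero]
      exact zero_le
  refine hle.trans_lt ?_
  rw [lintegral_const_mul' _ _ ENNReal.ofReal_ne_top]
  exact ENNReal.mul_lt_top ENNReal.ofReal_lt_top
    (lintegral_box_rpow_lt_top (by linarith) hR0.le)

lemma IsTestFunction.hardyTerm_lt_top {F : Type*} [NormedAddCommGroup F] [NormedSpace ℝ F] {n : ℕ}
    {s p α β : ℝ} (hp : 0 < p) {u : EuclideanSpace ℝ (Fin (n + 1)) → F}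
    (hu : IsTestFunction n s p α β u) : hardyTerm n s p α β u < ⊤ := by
  rcases hu with hu | ⟨hδ, hu⟩
  · exact hardyTerm_lt_top_of_open hp hu
  · exact hardyTerm_lt_top_of_closed hp hδ hu

lemma IsTestFunction.continuousOn {F : Type*} [NormedAddCommGroup F] [NormedSpace ℝ F] {n : ℕ}
    {s p α β : ℝ} {u : EuclideanSpace ℝ (Fin (n + 1)) → F}
    (hu : IsTestFunction n s p α β u) : ContinuousOn u (halfSpace n) := by
  rcases hu with hu | ⟨_, hu⟩
  · exact hu.1.continuousOn
  · exact hu.1.continuousOn.mono fun x (hx : 0 < x (Fin.last n)) => hx.le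

/-! ### Conclusion for test functions -/

/-- Values off the half-space are arbitrary, so global measurability is available only after cutting
them off. -/
lemma measurable_indicator_halfSpace {n : ℕ} {U : EuclideanSpace ℝ (Fin (n + 1)) → ℝ}
    (hU : ContinuousOn U (halfSpace n)) : Measurable ((halfSpace n).indicator U) := by
  classical
  rw [← Set.piecewise_eq_indicator]
  exact hU.measurable_piecewise continuousOn_const (measurableSet_halfSpace n)

lemma gapOn_univ {p : ℝ} (hp1 : 1 < p) (hp2 : p < 2) : GapOn p (remainderConst p) Set.univ :=
  fun A _ B _ _ _ ht => gap_of_real hp1 hp2 (A / B) ht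

lemma gapOn_nonneg {p : ℝ} (hp1 : 1 < p) (hp2 : p < 2) : GapOn p (p - 1) (Set.Ici 0) :=
  fun _ hA _ hB _ _ ht => gap_of_nonneg hp1 hp2 (div_nonneg hA hB) ht

/-- `U` stands for `u` or `‖u‖`; only its values on the half-space matter. -/
theorem IsTestFunction.hardyWithRemainder {F : Type*} [NormedAddCommGroup F] [NormedSpace ℝ F]
    {n : ℕ} {s p α β C : ℝ} (hs0 : 0 < s) (hs1 : s < 1) (hp1 : 1 < p) (hp2 : p < 2)
    (hα : α ∈ Set.Ioo (-1) (s * p)) (hβ : β ∈ Set.Ioo (-1) (s * p))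
    (hne : 1 + α + β ≠ s * p) (hC0 : 0 ≤ C) (hC : C ≤ p - 1) {S : Set ℝ}
    (hS : GapOn p C S) {u : EuclideanSpace ℝ (Fin (n + 1)) → F}
    (hu : IsTestFunction n s p α β u) {U : EuclideanSpace ℝ (Fin (n + 1)) → ℝ}
    (hU : ContinuousOn U (halfSpace n)) (hUnorm : ∀ x, |U x| = ‖u x‖)
    (hUsub : ∀ x y, |U x - U y| ≤ ‖u x - u y‖)
    (hUS : ∀ x ∈ halfSpace n, U x * x (Fin.last n) ^ ((1 + α + β - s * p) / p) ∈ S) :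
    HardyWithRemainder n s p α β C u
      (fun x => U x * x (Fin.last n) ^ ((1 + α + β - s * p) / p)) := by
  refine hardyWithRemainder_of_gapOn hs0 hs1 hp1 hp2 hα hβ hne hC0 hC hS
    (measurable_indicator_halfSpace hU) ?_ ?_ ?_ ?_ (hu.hardyTerm_lt_top (by linarith))
  · intro x hx; rw [Set.indicator_of_mem hx, hUnorm]
  · intro x hx y hy; rw [Set.indicator_of_mem hx, Set.indicator_of_mem hy]; exact hUsub x y
  · intro x hx; rw [Set.indicator_of_mem hx]; exact hUS x hx
  · intro x hx; rw [Set.indicator_of_mem hx]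

end HalfSpaceHardy

theorem mainTheorem3 (n : ℕ) (s p α β : ℝ) (hs0 : 0 < s) (hs1 : s < 1) (hp1 : 1 < p) (hp2 : p < 2)
    (hα : α ∈ Set.Ioo (-1) (s * p)) (hβ : β ∈ Set.Ioo (-1) (s * p))
    (hαβ : α + β ∈ Set.Ioo (-1) (s * p)) (hne : 1 + α + β ≠ s * p) :
    0 < HalfSpaceHardy.hardyConst (n + 1) s p α β ∧
    (∀ u : EuclideanSpace ℝ (Fin (n + 1)) → ℝ, HalfSpaceHardy.IsTestFunction n s p α β u →
      HalfSpaceHardy.HardyWithRemainder n s p α β (HalfSpaceHardy.remainderConst p) u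
        (fun x => u x * x (Fin.last n) ^ ((1 + α + β - s * p) / p))) ∧
    (∀ u : EuclideanSpace ℝ (Fin (n + 1)) → ℝ, HalfSpaceHardy.IsTestFunction n s p α β u →
      (∀ x ∈ HalfSpaceHardy.halfSpace n, 0 ≤ u x) →
      HalfSpaceHardy.HardyWithRemainder n s p α β (p - 1) u
        (fun x => u x * x (Fin.last n) ^ ((1 + α + β - s * p) / p))) ∧
    (∀ u : EuclideanSpace ℝ (Fin (n + 1)) → ℂ, HalfSpaceHardy.IsTestFunction n s p α β u →
      HalfSpaceHardy.HardyWithRemainder n s p α β (p - 1) u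
        (fun x => ‖u x‖ * x (Fin.last n) ^ ((1 + α + β - s * p) / p))) := by
  refine ⟨HalfSpaceHardy.hardyConst_pos hs0 hs1 hp1 hα hβ hne, fun u hu => ?_,
    fun u hu hnn => ?_, fun u hu => ?_⟩
  · exact hu.hardyWithRemainder hs0 hs1 hp1 hp2 hα hβ hne
      (HalfSpaceHardy.remainderConst_nonneg hp1) (HalfSpaceHardy.remainderConst_le hp1 hp2)
      (HalfSpaceHardy.gapOn_univ hp1 hp2) hu.continuousOn (fun _ => rfl) (fun _ _ => le_rfl)
      (fun _ _ => Set.mem_univ _)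
  · exact hu.hardyWithRemainder hs0 hs1 hp1 hp2 hα hβ hne (by linarith) le_rfl
      (HalfSpaceHardy.gapOn_nonneg hp1 hp2) hu.continuousOn (fun _ => rfl) (fun _ _ => le_rfl)
      (fun x hx => mul_nonneg (hnn x hx) (Real.rpow_nonneg (le_of_lt hx) _))
  · exact hu.hardyWithRemainder hs0 hs1 hp1 hp2 hα hβ hne (by linarith) le_rfl
      (HalfSpaceHardy.gapOn_nonneg hp1 hp2) hu.continuousOn.norm (fun _ => abs_norm _)
      (fun _ _ => abs_norm_sub_norm_le _ _)
      (fun x hx => mul_nonneg (norm_nonneg _) (Real.rpow_nonneg (le_of_lt hx) _))
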